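/- For a homogeneous polynomial $f\in S=\mathbb{C}[x,y,z]$ let $J_f=\langle\partial_x f,\partial_y f,\partial_z f\rangle$ be its Jacobian ideal. If the curve $\{f=0\}\subset\mathbb{P}^2_{\mathbb{C}}$ is reduced, let $\deg J_f$ be the degree of the scheme defined by $J_f$, i.e. the constant value of $\dim_{\mathbb{C}}(S/J_f)_t$ for all large $t$. A reduced curve $C=\{f=0\}\subset\mathbb{P}^2_{\mathbb{C}}$ of degree $e\ge 5$ whose singularities are all $\mathrm{ADE}$ singularities, ordinary quadruple points or $J_{2,0}$-singularities is called an $\mathscr{M}$-curve if $$\deg J_f=\begin{cases}3m^2-3m+3 & \text{if } e=2m,\\ 3m^2+1 & \text{if } e=2m+1.\end{cases}$$ An arrangement of curves is called an $\mathscr{M}$-arrangement if the union of its curves is an $\mathscr{M}$-curve. **Theorem.** Let $\mathcal{CL}\subset\mathbb{P}^2_{\mathbb{C}}$ be an arrangement of $k\ge 1$ smooth conics and $d\ge 3$ lines, pairwise distinct, all of whose singularities are ordinary points (the branches have pairwise distinct tangents) of multiplicity at most $4$. For $r\ge 2$ let $n_r$ be the number of points of the plane at which exactly $r$ curves of $\mathcal{CL}$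 meet. Assume that $\mathcal{CL}$ is an $\mathscr{M}$-arrangement. (i) If $d=2\ell$ for an integer $\ell$, then $n_2+2n_3+3n_4=(k+\ell)^2+\ell-k-3$. (ii) If $d=2\ell+1$ for an integer $\ell$, then $n_2+2n_3+3n_4=(k+\ell)^2+2\ell-1$. -/

import Mathlib

namespace MArrangement

open MvPolynomial

/-- The complex projective plane. -/
abbrev Plane : Type := Projectivization ℂ (Fin 3 → ℂ)

/-- The homogeneous coordinate ring `ℂ[x, y, z]`. -/
abbrev S : Type := MvPolynomial (Fin 3) ℂ

/-- The homogeneous polynomial `f` vanishes at `p` (for homogeneous `f` the choice of homogeneous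
coordinates of `p` does not matter). -/
def Vanishes (f : S) (p : Plane) : Prop :=
  eval p.rep f = 0

/-- `p` is a singular point of the curve `f = 0`. -/
def IsSingularPoint (f : S) (p : Plane) : Prop :=
  Vanishes f p ∧ ∀ i, Vanishes (pderiv i f) p

/-! ### Local equations and types of singularities -/

/-- The equation of the curve `f = 0` in the affine coordinates `(s, t) ↦ [v + s u + t w]`, which
are centred at the point `[v]` of the plane when `v, u, w` is a basis of `ℂ³`. -/
noncomputable def localEquation (f : S) (v u w : Fin 3 → ℂ) : MvPolynomial (Fin 2) ℂ :=
  aeval (fun i => C (v i) + C (u i) * X 0 + C (w i) * X 1) f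

/-- `g` is an equation of the curve `f = 0` in affine coordinates centred at `p`. -/
def IsLocalEquation (f : S) (p : Plane) (g : MvPolynomial (Fin 2) ℂ) : Prop :=
  ∃ u w : Fin 3 → ℂ, LinearIndependent ℂ ![p.rep, u, w] ∧ g = localEquation f p.rep u w

/-- `p` is an ordinary point of multiplicity `r` of the curve `f = 0`: the local equation starts
in degree `r`, and its tangent cone consists of `r` distinct lines. -/
def IsOrdinaryPoint (f : S) (p : Plane) (r : ℕ) : Prop :=
  ∃ g, IsLocalEquation f p g ∧ (∀ j < r, homogeneousComponent j g = 0) ∧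
    homogeneousComponent r g ≠ 0 ∧ Squarefree (homogeneousComponent r g)

/-- The germ of the curve `f = 0` at `p` is contact equivalent to the germ of `h = 0` at the
origin: up to a formal change of coordinates and a unit, `f` is locally given by `h`. -/
def HasType (f : S) (p : Plane) (h : MvPolynomial (Fin 2) ℂ) : Prop :=
  ∃ g, IsLocalEquation f p g ∧
    ∃ φ : MvPowerSeries (Fin 2) ℂ ≃ₐ[ℂ] MvPowerSeries (Fin 2) ℂ,
      Associated (φ (g : MvPowerSeries (Fin 2) ℂ)) (h : MvPowerSeries (Fin 2) ℂ)

/-- `p` is a singularity of type `Aₙ` (`n ≥ 1`), `Dₙ` (`n ≥ 4`), `E₆`, `E₇` or `E₈`. -/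
def IsADE (f : S) (p : Plane) : Prop :=
  (∃ n : ℕ, 1 ≤ n ∧ HasType f p (X 0 ^ 2 + X 1 ^ (n + 1))) ∨
  (∃ n : ℕ, 4 ≤ n ∧ HasType f p (X 0 ^ 2 * X 1 + X 1 ^ (n - 1))) ∨
  HasType f p (X 0 ^ 3 + X 1 ^ 4) ∨
  HasType f p (X 0 ^ 3 + X 0 * X 1 ^ 3) ∨
  HasType f p (X 0 ^ 3 + X 1 ^ 5)

/-- `p` is a singularity of type `J_{2,0}`. -/
def IsJ20 (f : S) (p : Plane) : Prop :=
  ∃ a : ℂ, 4 * a ^ 3 + 27 ≠ 0 ∧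
    HasType f p (X 0 ^ 3 + C a * X 0 ^ 2 * X 1 ^ 2 + X 1 ^ 6)

/-- `p` is a simple elliptic singularity of a plane curve: an ordinary quadruple point or a
`J_{2,0}` singularity. -/
def IsSimpleElliptic (f : S) (p : Plane) : Prop :=
  IsOrdinaryPoint f p 4 ∨ IsJ20 f p

/-! ### The degree of the Jacobian ideal -/

/-- The Jacobian ideal of `f`, generated by the partial derivatives of `f`. -/
noncomputable def jacobianIdeal (f : S) : Ideal S :=
  Ideal.span (Set.range fun i => pderiv i f)

/-- The Hilbert function `t ↦ dim S_t / (I ∩ S_t)` of `S / I`, for a homogeneous ideal `I`. -/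
noncomputable def hilbertFunction (I : Ideal S) (t : ℕ) : ℕ :=
  Module.finrank ℂ
    (homogeneousSubmodule (Fin 3) ℂ t ⧸
      (I.restrictScalars ℂ).comap (homogeneousSubmodule (Fin 3) ℂ t).subtype)

/-- The homogeneous ideal `I` defines a subscheme of the plane that is finite (or empty), and the
degree of this subscheme is `δ`: the Hilbert polynomial of `S / I` is the constant `δ`. -/
def HasDegree (I : Ideal S) (δ : ℕ) : Prop :=
  ∀ᶠ t in Filter.atTop, hilbertFunction I t = δ

/-! ### `ℳ`-curves and arrangements of conics and lines -/

/-- `f = 0` is an `ℳ`-curve of degree `e`. -/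
structure IsMCurve (f : S) (e : ℕ) : Prop where
  homogeneous : f.IsHomogeneous e
  reduced : Squarefree f
  five_le : 5 ≤ e
  singularities : ∀ p, IsSingularPoint f p → IsADE f p ∨ IsSimpleElliptic f p
  degree : ∃ δ : ℕ, HasDegree (jacobianIdeal f) δ ∧
    (∀ m : ℕ, e = 2 * m → (δ : ℤ) = 3 * (m : ℤ) ^ 2 - 3 * m + 3) ∧
    (∀ m : ℕ, e = 2 * m + 1 → (δ : ℤ) = 3 * (m : ℤ) ^ 2 + 1)

/-- An arrangement of `k` smooth conics and `d` lines in the complex projective plane, pairwise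
distinct, each given by a homogeneous equation. -/
structure ConicLineArrangement (k d : ℕ) where
  conic : Fin k → S
  line : Fin d → S
  conic_homogeneous : ∀ i, (conic i).IsHomogeneous 2
  conic_smooth : ∀ i p, ¬ IsSingularPoint (conic i) p
  conic_distinct : ∀ i j, i ≠ j → ¬ Associated (conic i) (conic j)
  line_homogeneous : ∀ i, (line i).IsHomogeneous 1
  line_ne_zero : ∀ i, line i ≠ 0
  line_distinct : ∀ i j, i ≠ j → ¬ Associated (line i) (line j)

namespace ConicLineArrangement

variable {k d : ℕ}

/-- The curves of the arrangement, indexed by one set. -/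
def component (A : ConicLineArrangement k d) : Fin k ⊕ Fin d → S :=
  Sum.elim A.conic A.line

/-- The equation of the union of all curves of the arrangement. -/
noncomputable def definingPolynomial (A : ConicLineArrangement k d) : S :=
  ∏ i, A.component i

/-- `n_r`, the number of points of the plane where exactly `r` curves of the arrangement meet. -/
noncomputable def n (A : ConicLineArrangement k d) (r : ℕ) : ℕ :=
  {p : Plane | {i | Vanishes (A.component i) p}.ncard = r}.ncard

/-- All singularities are ordinary points of multiplicity at most `r`. -/
def HasOrdinarySingularities (A : ConicLineArrangement k d) (r : ℕ) : Prop :=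
  ∀ p, IsSingularPoint A.definingPolynomial p →
    ∃ j ≤ r, IsOrdinaryPoint A.definingPolynomial p j

/-- The union of the curves, a curve of degree `2 k + d`, is an `ℳ`-curve. -/
def IsMArrangement (A : ConicLineArrangement k d) : Prop :=
  IsMCurve A.definingPolynomial (2 * k + d)

end ConicLineArrangement

end MArrangement

/-!
The degree of the Jacobian scheme and Bézout's theorem both count the singular points of the
arrangement. All singular points are ordinary, of multiplicity `r ≤ 4`, and `r` is the number of
curves through the point, since each curve is smooth. Such a point contributes `(r - 1) ^ 2` to the
degree `δ` of the Jacobian scheme, and `r (r - 1)` to the intersection numbers of all ordered pairs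
of distinct curves, whose sum is `(2 k + d) ^ 2 - (4 k + d)`. The difference of the contributions is
`r - 1`, so `n₂ + 2 n₃ + 3 n₄ = (2 k + d) ^ 2 - (4 k + d) - δ`
(`ConicLineArrangement.n_add_n_add_n_eq`), and the value of `δ` for an `ℳ`-curve gives the result.

Both counts rest on `HasDegree.eq_sum`: the constant Hilbert polynomial of a homogeneous ideal `I`
with finitely many zeros is the sum of the local multiplicities of `I`. A line `l = 0` that misses
the zeros is chosen. By the Nullstellensatz, multiplication by `l` is surjective on `S / I` in large
degrees, hence bijective, and `δ` is the dimension of `S / (I + (l - 1))`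
(`HasDegree.finrank_quotient_sup`). The Chinese remainder theorem splits this algebra into local
parts (`finrank_quotient_eq_sum`).

The local parts are computed for two germs whose tangent cones are coprime forms of degree `e`: the
multiplicity is `e ^ 2` (`finrank_quotient_span_pair_sup`), and by Nakayama's lemma the ideal of the
germs contains `m ^ (2 e - 1)` (`exists_notMem_mul_mem`). For two curves of the arrangement `e = 1`,
and the Koszul resolution gives the Hilbert polynomial (`hasDegree_span_pair`). For the Jacobian
ideal the germs are the derivatives of the local equation `g`, with `e = r - 1`; their tangent
cones are coprime because the tangent cone of `g` is squarefree, and `g` itself lies in their ideal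
up to `m ^ (2 e - 1)` because `r ≤ 4` (`mem_span_pderiv_sup`). Since the notion of an ordinary
point concerns one affine chart, it is translated into the linear independence of gradients, which
does not depend on the chart (`squarefree_linearPart_prod_iff`).
-/

namespace MArrangement

open MvPolynomial

/-! ### Homogeneous components -/

section Components

variable {σ R : Type*} [CommRing R]

theorem mem_idealOfVars_pow_iff_homogeneousComponent (n : ℕ) (p : MvPolynomial σ R) :
    p ∈ idealOfVars σ R ^ n ↔ ∀ j < n, homogeneousComponent j p = 0 := by
  rw [mem_pow_idealOfVars_iff']
  constructor
  · intro h j hj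
    ext d
    rw [coeff_homogeneousComponent, coeff_zero]
    split_ifs with hd
    · exact h d (hd ▸ hj)
    · rfl
  · intro h d hd
    have := congrArg (coeff d) (h _ hd)
    simpa [coeff_homogeneousComponent] using this

theorem _root_.MvPolynomial.IsHomogeneous.mem_idealOfVars_pow {p : MvPolynomial σ R} {n : ℕ}
    (hp : p.IsHomogeneous n) : p ∈ idealOfVars σ R ^ n := by
  rw [mem_idealOfVars_pow_iff_homogeneousComponent]
  intro j hj
  rw [homogeneousComponent_of_mem ((mem_homogeneousSubmodule _ _).2 hp), if_neg hj.ne]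

theorem sub_homogeneousComponent_mem {p : MvPolynomial σ R} {n : ℕ}
    (hp : p ∈ idealOfVars σ R ^ n) :
    p - homogeneousComponent n p ∈ idealOfVars σ R ^ (n + 1) := by
  rw [mem_idealOfVars_pow_iff_homogeneousComponent] at hp ⊢
  intro j hj
  rw [map_sub, homogeneousComponent_of_mem (homogeneousComponent_mem n p)]
  rcases Nat.lt_succ_iff_lt_or_eq.1 hj with h | rfl
  · rw [if_neg h.ne, hp j h, sub_zero]
  · rw [if_pos rfl, sub_self]

theorem homogeneousComponent_eq_of_sub_mem {p q : MvPolynomial σ R} {n : ℕ}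
    (h : p - q ∈ idealOfVars σ R ^ (n + 1)) (hq : q.IsHomogeneous n) :
    homogeneousComponent n p = q := by
  have := (mem_idealOfVars_pow_iff_homogeneousComponent _ _).1 h n (Nat.lt_succ_self n)
  rw [map_sub, homogeneousComponent_eq_self ((mem_homogeneousSubmodule _ _).2 hq)] at this
  exact sub_eq_zero.1 this

theorem homogeneousComponent_add_mul {p q : MvPolynomial σ R} {a b : ℕ}
    (hp : p ∈ idealOfVars σ R ^ a) (hq : q ∈ idealOfVars σ R ^ b) :
    homogeneousComponent (a + b) (p * q) = homogeneousComponent a p * homogeneousComponent b q := by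
  apply homogeneousComponent_eq_of_sub_mem
  · have h : p * q - homogeneousComponent a p * homogeneousComponent b q =
        (p - homogeneousComponent a p) * q +
          homogeneousComponent a p * (q - homogeneousComponent b q) := by ring
    rw [h]
    refine add_mem ?_ ?_
    · have := Ideal.mul_mem_mul (sub_homogeneousComponent_mem hp) hq
      rwa [← pow_add, show a + 1 + b = a + b + 1 by ring] at this
    · have := Ideal.mul_mem_mul (homogeneousComponent_isHomogeneous a p).mem_idealOfVars_pow
        (sub_homogeneousComponent_mem hq)
      rwa [← pow_add, ← add_assoc] at this
  · exact (homogeneousComponent_isHomogeneous a p).mul (homogeneousComponent_isHomogeneous b q)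

theorem prod_mem_idealOfVars_pow {ι : Type*} (s : Finset ι) (p : ι → MvPolynomial σ R) (a : ι → ℕ)
    (hp : ∀ i ∈ s, p i ∈ idealOfVars σ R ^ a i) :
    ∏ i ∈ s, p i ∈ idealOfVars σ R ^ ∑ i ∈ s, a i := by
  rw [← Finset.prod_pow_eq_pow_sum]
  exact Ideal.prod_mem_prod hp

theorem homogeneousComponent_sum_prod {ι : Type*} (s : Finset ι) (p : ι → MvPolynomial σ R)
    (a : ι → ℕ) (hp : ∀ i ∈ s, p i ∈ idealOfVars σ R ^ a i) :
    homogeneousComponent (∑ i ∈ s, a i) (∏ i ∈ s, p i) =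
      ∏ i ∈ s, homogeneousComponent (a i) (p i) := by
  classical
  induction s using Finset.induction_on with
  | empty => simp
  | insert i s hi ih =>
    rw [Finset.sum_insert hi, Finset.prod_insert hi, Finset.prod_insert hi,
      homogeneousComponent_add_mul (hp i (by simp))
        (prod_mem_idealOfVars_pow s p a fun j hj => hp j (by simp [hj])),
      ih fun j hj => hp j (by simp [hj])]

theorem homogeneousComponent_mul_of_isHomogeneous {l : MvPolynomial σ R} {n : ℕ}
    (hl : l.IsHomogeneous n) (h : MvPolynomial σ R) (k : ℕ) :
    homogeneousComponent (n + k) (l * h) = l * homogeneousComponent k h := by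
  classical
  conv_lhs => rw [← sum_homogeneousComponent h, Finset.mul_sum, map_sum]
  have : ∀ i, homogeneousComponent (n + k) (l * homogeneousComponent i h) =
      if i = k then l * homogeneousComponent k h else 0 := by
    intro i
    rw [homogeneousComponent_of_mem ((mem_homogeneousSubmodule _ _).2
      (hl.mul (homogeneousComponent_isHomogeneous i h)))]
    by_cases hik : i = k
    · simp [hik]
    · rw [if_neg (by omega), if_neg hik]
  rw [Finset.sum_congr rfl fun i _ => this i, Finset.sum_ite_eq']
  split_ifs with hk
  · rfl
  · rw [homogeneousComponent_eq_zero k h (by simpa using hk), mul_zero]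

theorem homogeneousComponent_mul_of_lt {l : MvPolynomial σ R} {n k : ℕ}
    (hl : l.IsHomogeneous n) (h : MvPolynomial σ R) (hk : k < n) :
    homogeneousComponent k (l * h) = 0 :=
  (mem_idealOfVars_pow_iff_homogeneousComponent n _).1
    (Ideal.mul_mem_right _ _ hl.mem_idealOfVars_pow) k hk

theorem homogeneousComponent_mem_span {ι : Type*} {c : ι → MvPolynomial σ R} {n : ι → ℕ}
    (hc : ∀ i, (c i).IsHomogeneous (n i)) {g : MvPolynomial σ R}
    (hg : g ∈ Ideal.span (Set.range c)) (j : ℕ) :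
    homogeneousComponent j g ∈ Ideal.span (Set.range c) := by
  induction hg using Submodule.span_induction generalizing j with
  | mem x hx =>
    obtain ⟨i, rfl⟩ := hx
    rw [homogeneousComponent_of_mem ((mem_homogeneousSubmodule _ _).2 (hc i))]
    split_ifs
    · exact Ideal.subset_span ⟨i, rfl⟩
    · exact zero_mem _
  | zero => simp
  | add x y _ _ hx hy => rw [map_add]; exact add_mem (hx j) (hy j)
  | smul a x hx ih =>
    rw [smul_eq_mul, ← sum_homogeneousComponent a, Finset.sum_mul, map_sum]
    refine sum_mem fun k _ => ?_
    by_cases hk : k ≤ j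
    · obtain ⟨l, rfl⟩ := Nat.exists_eq_add_of_le hk
      rw [homogeneousComponent_mul_of_isHomogeneous (homogeneousComponent_isHomogeneous k a)]
      exact Ideal.mul_mem_left _ _ (ih l)
    · rw [homogeneousComponent_mul_of_lt (homogeneousComponent_isHomogeneous k a) _ (by omega)]
      exact zero_mem _

end Components

/-! ### Dimensions -/

theorem finrank_homogeneousSubmodule {σ K : Type*} [Field K] [Fintype σ] [DecidableEq σ] (n : ℕ) :
    Module.finrank K (homogeneousSubmodule σ K n) =
      (Fintype.card σ + n - 1).choose n := by
  rw [homogeneousSubmodule_eq_finsupp_supported]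
  have := Module.finrank_eq_nat_card_basis (basisRestrictSupport K {d : σ →₀ ℕ | d.degree = n})
  refine Eq.trans this ?_
  rw [← Sym.card_sym_eq_choose, ← Nat.card_eq_fintype_card]
  refine Nat.card_congr ((Sym.equivNatSum σ n).trans (Equiv.subtypeEquivRight fun d => ?_)).symm
  rw [Set.mem_ofPred_eq, Finsupp.degree_apply, Finsupp.sum]
  rfl

/-! ### The local algebra of a pair of plane curve germs with coprime tangent cones -/

section Local

variable {σ K : Type*} [Field K]

theorem ne_zero_of_isRelPrime {p q : MvPolynomial σ K} {e : ℕ} (he : 1 ≤ e)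
    (hp : p.IsHomogeneous e) (h : IsRelPrime p q) : q ≠ 0 := by
  rintro rfl
  have hu : IsUnit p := isRelPrime_zero_right.1 h
  have h0 := hp.totalDegree hu.ne_zero
  have := (isUnit_iff_totalDegree_of_isReduced.1 hu).2
  omega

/-- Coprime forms have no syzygy below the Koszul degree. -/
theorem eq_zero_of_mul_add_mul_eq_zero {p q α β : MvPolynomial σ K} {a b j : ℕ}
    (ha : 1 ≤ a) (hp : p.IsHomogeneous a) (hq : q.IsHomogeneous b) (h : IsRelPrime p q)
    (hα : α.IsHomogeneous j) (hj : j < b) (heq : α * p + β * q = 0) : α = 0 ∧ β = 0 := by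
  have hq0 := ne_zero_of_isRelPrime ha hp h
  have hdvd : q ∣ α * p := ⟨-β, by linear_combination heq⟩
  have hα0 : α = 0 := by
    by_contra hα0
    have h1 := totalDegree_le_of_dvd_of_isDomain (h.symm.dvd_of_dvd_mul_right hdvd) hα0
    rw [hα.totalDegree hα0, hq.totalDegree hq0] at h1
    omega
  subst hα0
  refine ⟨rfl, ?_⟩
  rw [zero_mul, zero_add] at heq
  exact (mul_eq_zero.1 heq).resolve_right hq0

/-- The linear map `(α, β) ↦ α p + β q` on pairs of forms of degrees `a` and `b`. -/
noncomputable def formPairing (p q : MvPolynomial σ K) (a b : ℕ) :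
    homogeneousSubmodule σ K a × homogeneousSubmodule σ K b →ₗ[K] MvPolynomial σ K :=
  (((LinearMap.mulRight K p).comp (homogeneousSubmodule σ K a).subtype).coprod
    ((LinearMap.mulRight K q).comp (homogeneousSubmodule σ K b).subtype))

instance [Finite σ] (n : ℕ) : Module.Finite K (homogeneousSubmodule σ K n) :=
  Module.Finite.of_fg (homogeneousSubmodule_fg σ K n)

theorem finrank_homogeneousSubmodule_two (n : ℕ) :
    Module.finrank K (homogeneousSubmodule (Fin 2) K n) = n + 1 := by
  rw [finrank_homogeneousSubmodule, Fintype.card_fin, show 2 + n - 1 = n + 1 by omega,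
    Nat.choose_succ_self_right]

/-- Two coprime binary forms of degree `e + 1` generate all binary forms of degree `2 e + 1`: there
are no syzygies with coefficients of degree `e`, and the dimensions agree. -/
theorem exists_eq_mul_add_mul {p q f : MvPolynomial (Fin 2) K} {e : ℕ}
    (hp : p.IsHomogeneous (e + 1)) (hq : q.IsHomogeneous (e + 1)) (h : IsRelPrime p q)
    (hf : f.IsHomogeneous (2 * e + 1)) :
    ∃ α β : MvPolynomial (Fin 2) K, α.IsHomogeneous e ∧ β.IsHomogeneous e ∧
      f = α * p + β * q := by
  have hinj : Function.Injective (formPairing p q e e) := by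
    rw [← LinearMap.ker_eq_bot, LinearMap.ker_eq_bot']
    rintro ⟨⟨α, hα⟩, ⟨β, hβ⟩⟩ h0
    obtain ⟨h1, h2⟩ : α = 0 ∧ β = 0 :=
      eq_zero_of_mul_add_mul_eq_zero (by omega) hp hq h hα (by omega) h0
    simp [h1, h2]
  have hle : LinearMap.range (formPairing p q e e) ≤
      homogeneousSubmodule (Fin 2) K (2 * e + 1) := by
    rintro _ ⟨⟨⟨α, hα⟩, ⟨β, hβ⟩⟩, rfl⟩
    rw [show 2 * e + 1 = e + (e + 1) by ring]
    exact add_mem (IsHomogeneous.mul hα hp) (IsHomogeneous.mul hβ hq)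
  have heq := Submodule.eq_of_le_of_finrank_eq hle (by
    rw [LinearMap.finrank_range_of_inj hinj, Module.finrank_prod,
      finrank_homogeneousSubmodule_two, finrank_homogeneousSubmodule_two]
    ring)
  obtain ⟨⟨⟨α, hα⟩, ⟨β, hβ⟩⟩, hx⟩ : f ∈ LinearMap.range (formPairing p q e e) := heq ▸ hf
  exact ⟨α, β, hα, hβ, hx.symm⟩

/-- The homogeneous components of degree less than `N`; the kernel of this map is the `N`-th power
of the ideal of the origin. -/
noncomputable def lowComponents (σ K : Type*) [Field K] (N : ℕ) :
    MvPolynomial σ K →ₗ[K] ((n : Fin N) → homogeneousSubmodule σ K n) :=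
  LinearMap.pi fun n => (homogeneousComponent (n : ℕ)).codRestrict _
    fun p => homogeneousComponent_mem n p

theorem mem_ker_lowComponents {N : ℕ} {p : MvPolynomial σ K} :
    p ∈ LinearMap.ker (lowComponents σ K N) ↔ p ∈ idealOfVars σ K ^ N := by
  rw [mem_idealOfVars_pow_iff_homogeneousComponent, LinearMap.mem_ker, funext_iff, Fin.forall_iff]
  exact forall_congr' fun j => forall_congr' fun hj => Subtype.ext_iff

theorem lowComponents_sum {N : ℕ} (x : (n : Fin N) → homogeneousSubmodule σ K n) :
    lowComponents σ K N (∑ n, (x n : MvPolynomial σ K)) = x := by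
  ext j : 2
  change homogeneousComponent (j : ℕ) (∑ n, (x n : MvPolynomial σ K)) = x j
  rw [map_sum, Finset.sum_eq_single j]
  · exact homogeneousComponent_eq_self (x j).2
  · intro i _ hij
    rw [homogeneousComponent_of_mem (x i).2, if_neg (fun h => hij (Fin.ext h.symm))]
  · simp

/-- Dimension of the quotient by an ideal containing a power of the ideal of the origin. -/
theorem finite_finrank_quotient_add [Finite σ] {N : ℕ} {I : Ideal (MvPolynomial σ K)}
    (hI : idealOfVars σ K ^ N ≤ I) :
    Module.Finite K (MvPolynomial σ K ⧸ I) ∧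
    Module.finrank K (MvPolynomial σ K ⧸ I) +
      Module.finrank K ((I.restrictScalars K).map (lowComponents σ K N)) =
      ∑ n ∈ Finset.range N, Module.finrank K (homogeneousSubmodule σ K n) := by
  set T := lowComponents σ K N
  set V := (I.restrictScalars K).map T
  have hsurj : Function.Surjective (V.mkQ ∘ₗ T) :=
    (Submodule.mkQ_surjective V).comp fun x => ⟨_, lowComponents_sum x⟩
  have hker : LinearMap.ker (V.mkQ ∘ₗ T) = I.restrictScalars K := by
    rw [LinearMap.ker_comp, Submodule.ker_mkQ, Submodule.comap_map_eq, sup_eq_left]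
    intro x hx
    exact hI (mem_ker_lowComponents.1 hx)
  let e := (Submodule.quotEquivOfEq _ _ hker.symm).trans
    (LinearMap.quotKerEquivOfSurjective _ hsurj)
  let e' : (MvPolynomial σ K ⧸ I) ≃ₗ[K] (MvPolynomial σ K ⧸ I.restrictScalars K) :=
    (Submodule.Quotient.restrictScalarsEquiv K I).symm
  let e'' := e'.trans e
  refine ⟨Module.Finite.equiv e''.symm, ?_⟩
  rw [LinearEquiv.finrank_eq e'', Submodule.finrank_quotient_add_finrank,
    Module.finrank_pi_fintype, Finset.sum_range]

variable {P Q : MvPolynomial (Fin 2) K} {e : ℕ}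

/-- If the tangent cones of two germs are coprime of degree `e + 1`, then the ideal of the germs
contains `m ^ (2 e + 1)` locally at the origin. This is Nakayama's lemma, applied to the inclusion
of `m ^ (2 e + 1)` in `(P, Q) + m ^ (2 e + 2)`. -/
theorem exists_notMem_mul_mem (hP : P ∈ idealOfVars (Fin 2) K ^ (e + 1))
    (hQ : Q ∈ idealOfVars (Fin 2) K ^ (e + 1))
    (h : IsRelPrime (homogeneousComponent (e + 1) P) (homogeneousComponent (e + 1) Q)) :
    ∃ u, u ∉ idealOfVars (Fin 2) K ∧
      ∀ x ∈ idealOfVars (Fin 2) K ^ (2 * e + 1), u * x ∈ Ideal.span {P, Q} := by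
  set m := idealOfVars (Fin 2) K
  have hfg : (m ^ (2 * e + 1)).FG := (idealOfVars_fg (Fin 2) K).pow
  have hle : m ^ (2 * e + 1) ≤ Ideal.span {P, Q} ⊔ m • m ^ (2 * e + 1) := by
    intro x hx
    obtain ⟨α, β, hα, hβ, hx'⟩ := exists_eq_mul_add_mul
      (homogeneousComponent_isHomogeneous (e + 1) P)
      (homogeneousComponent_isHomogeneous (e + 1) Q) h
      (homogeneousComponent_isHomogeneous (2 * e + 1) x)
    have hxs : x = (α * P + β * Q) + ((x - homogeneousComponent (2 * e + 1) x) -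
        (α * (P - homogeneousComponent (e + 1) P) + β * (Q - homogeneousComponent (e + 1) Q))) := by
      linear_combination hx'
    rw [hxs]
    refine Submodule.add_mem_sup
      (Ideal.mem_span_pair.2 ⟨α, β, rfl⟩) ?_
    rw [smul_eq_mul, ← pow_succ']
    refine sub_mem (sub_homogeneousComponent_mem hx) (add_mem ?_ ?_)
    · have := Ideal.mul_mem_mul hα.mem_idealOfVars_pow (sub_homogeneousComponent_mem hP)
      rwa [← pow_add, show e + (e + 1 + 1) = 2 * e + 1 + 1 by ring] at this
    · have := Ideal.mul_mem_mul hβ.mem_idealOfVars_pow (sub_homogeneousComponent_mem hQ)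
      rwa [← pow_add, show e + (e + 1 + 1) = 2 * e + 1 + 1 by ring] at this
  obtain ⟨r, hr, hr'⟩ := Submodule.exists_sub_one_mem_and_smul_le_of_fg_of_le_sup hfg le_rfl hle
  refine ⟨r, fun hrm => ?_, fun x hx => hr' (Submodule.smul_mem_pointwise_smul x r _ hx)⟩
  have h1 : (1 : MvPolynomial (Fin 2) K) ∈ m ^ 1 := by
    rw [pow_one]; simpa using sub_mem hrm hr
  rw [mem_pow_idealOfVars_iff'] at h1
  simpa using h1 0 (by simp)

/-- Two germs with coprime tangent cones of degree `e + 1` have no syzygy of degree less than `e`,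
even modulo `m ^ (2 e + 1)`: its lowest component would be a syzygy of the tangent cones. -/
theorem eq_zero_of_mul_add_mul_mem_pow (hP : P ∈ idealOfVars (Fin 2) K ^ (e + 1))
    (hQ : Q ∈ idealOfVars (Fin 2) K ^ (e + 1))
    (h : IsRelPrime (homogeneousComponent (e + 1) P) (homogeneousComponent (e + 1) Q))
    {α β : MvPolynomial (Fin 2) K} (hα : α.totalDegree < e) (hβ : β.totalDegree < e)
    (h0 : α * P + β * Q ∈ idealOfVars (Fin 2) K ^ (2 * e + 1)) : α = 0 ∧ β = 0 := by
  have key : ∀ j, ∀ i < j, homogeneousComponent i α = 0 ∧ homogeneousComponent i β = 0 := by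
    intro j
    induction j with
    | zero => simp
    | succ j ih =>
      intro i hi
      rcases Nat.lt_succ_iff_lt_or_eq.1 hi with hi | rfl
      · exact ih i hi
      by_cases hie : e ≤ i
      · exact ⟨homogeneousComponent_eq_zero _ _ (by omega),
          homogeneousComponent_eq_zero _ _ (by omega)⟩
      have h1 := (mem_idealOfVars_pow_iff_homogeneousComponent i α).2 fun l hl => (ih l hl).1
      have h2 := (mem_idealOfVars_pow_iff_homogeneousComponent i β).2 fun l hl => (ih l hl).2
      have h3 := (mem_idealOfVars_pow_iff_homogeneousComponent _ _).1 h0 (i + (e + 1)) (by omega)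
      rw [map_add, homogeneousComponent_add_mul h1 hP, homogeneousComponent_add_mul h2 hQ] at h3
      exact eq_zero_of_mul_add_mul_eq_zero (by omega) (homogeneousComponent_isHomogeneous _ _)
        (homogeneousComponent_isHomogeneous _ _) h (homogeneousComponent_isHomogeneous _ _)
        (by omega) h3
  constructor
  · rw [← sum_homogeneousComponent α]
    exact Finset.sum_eq_zero fun i _ => (key (i + 1) i (by omega)).1
  · rw [← sum_homogeneousComponent β]
    exact Finset.sum_eq_zero fun i _ => (key (i + 1) i (by omega)).2

/-- If the tangent cones of two germs are coprime of degree `e + 1`, then the intersection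
multiplicity of the germs is `(e + 1) ^ 2`: the pairs of polynomials of degree less than `e` map
isomorphically onto the image of `(P, Q)` modulo `m ^ (2 e + 1)`. -/
theorem finrank_quotient_span_pair_sup (hP : P ∈ idealOfVars (Fin 2) K ^ (e + 1))
    (hQ : Q ∈ idealOfVars (Fin 2) K ^ (e + 1))
    (h : IsRelPrime (homogeneousComponent (e + 1) P) (homogeneousComponent (e + 1) Q)) :
    Module.finrank K (MvPolynomial (Fin 2) K ⧸
      (Ideal.span {P, Q} ⊔ idealOfVars (Fin 2) K ^ (2 * e + 1))) = (e + 1) ^ 2 := by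
  set m := idealOfVars (Fin 2) K
  set T := lowComponents (Fin 2) K (2 * e + 1)
  set I := Ideal.span {P, Q} ⊔ m ^ (2 * e + 1)
  have hdim := (finite_finrank_quotient_add (N := 2 * e + 1) (I := I) le_sup_right).2
  let W := ((n : Fin e) → homogeneousSubmodule (Fin 2) K n)
  let s : W →ₗ[K] MvPolynomial (Fin 2) K :=
    LinearMap.lsum K _ K fun n => (homogeneousSubmodule (Fin 2) K n).subtype
  have hs : ∀ x : W, s x = ∑ n, (x n : MvPolynomial (Fin 2) K) := fun x => by
    simp only [s, LinearMap.lsum_apply, LinearMap.sum_apply]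
    rfl
  have hsdeg : ∀ x : W, x = 0 ∨ (s x).totalDegree < e := by
    intro x
    rcases Nat.eq_zero_or_pos e with rfl | he
    · left; exact Subsingleton.elim _ _
    right
    rw [hs]
    refine (totalDegree_finsetSum_le (d := e - 1) fun n _ => ?_).trans_lt (by omega)
    exact (IsHomogeneous.totalDegree_le (x n).2).trans (by omega)
  have hsinj : ∀ x : W, s x = 0 → x = 0 := fun x hx => by
    rw [← lowComponents_sum x, ← hs, hx, map_zero]
  let Φ : W × W →ₗ[K] MvPolynomial (Fin 2) K :=
    ((LinearMap.mulRight K P).comp s).coprod ((LinearMap.mulRight K Q).comp s)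
  have hΦ : ∀ x, Φ x = s x.1 * P + s x.2 * Q := fun x => rfl
  have hinj : Function.Injective (T ∘ₗ Φ) := by
    rw [← LinearMap.ker_eq_bot, LinearMap.ker_eq_bot']
    rintro ⟨x, y⟩ hxy
    have hmem := mem_ker_lowComponents.1 (LinearMap.mem_ker.2 hxy)
    rw [hΦ] at hmem
    rcases Nat.eq_zero_or_pos e with rfl | he
    · exact Subsingleton.elim _ _
    have hd : ∀ x : W, (s x).totalDegree < e := fun x => by
      rcases hsdeg x with rfl | h
      · simpa using he
      · exact h
    obtain ⟨h1, h2⟩ := eq_zero_of_mul_add_mul_mem_pow hP hQ h (hd x) (hd y) hmem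
    rw [hsinj x h1, hsinj y h2]; rfl
  have hlow : ∀ a : MvPolynomial (Fin 2) K, ∃ x : W, a - s x ∈ m ^ e := fun a => by
    refine ⟨lowComponents (Fin 2) K e a, ?_⟩
    rw [← mem_ker_lowComponents, LinearMap.mem_ker, map_sub, hs, lowComponents_sum, sub_self]
  -- terms of degree at least `e` in the coefficients contribute only to `m ^ (2 e + 1)`
  have hrange : (I.restrictScalars K).map T = LinearMap.range (T ∘ₗ Φ) := by
    apply le_antisymm
    · rintro _ ⟨z, hz, rfl⟩
      obtain ⟨z₁, hz₁, z₂, hz₂, rfl⟩ := Submodule.mem_sup.1 (show z ∈ I from hz)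
      obtain ⟨a, b, rfl⟩ := Ideal.mem_span_pair.1 hz₁
      obtain ⟨x, hx⟩ := hlow a
      obtain ⟨y, hy⟩ := hlow b
      refine ⟨(x, y), ?_⟩
      rw [LinearMap.comp_apply, hΦ, ← sub_eq_zero, ← map_sub, ← LinearMap.mem_ker,
        mem_ker_lowComponents]
      have : s x * P + s y * Q - (a * P + b * Q + z₂) =
          -((a - s x) * P + (b - s y) * Q + z₂) := by ring
      rw [this]
      have h1 := Ideal.mul_mem_mul hx hP
      have h2 := Ideal.mul_mem_mul hy hQ
      rw [← pow_add, show e + (e + 1) = 2 * e + 1 by ring] at h1 h2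
      exact neg_mem (add_mem (add_mem h1 h2) hz₂)
    · rintro _ ⟨x, rfl⟩
      exact ⟨Φ x, Submodule.mem_sup_left (Ideal.mem_span_pair.2 ⟨_, _, rfl⟩), rfl⟩
  rw [hrange, LinearMap.finrank_range_of_inj hinj, Module.finrank_prod,
    Module.finrank_pi_fintype] at hdim
  simp only [finrank_homogeneousSubmodule_two] at hdim
  rw [← Finset.sum_range (fun n => n + 1)] at hdim
  have hsum : ∀ n, 2 * ∑ i ∈ Finset.range n, (i + 1) = n * (n + 1) := fun n => by
    induction n with
    | zero => simp
    | succ n ih => rw [Finset.sum_range_succ, mul_add, ih]; ring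
  have h1 := hsum e
  have h2 := hsum (2 * e + 1)
  nlinarith

end Local

/-! ### Hilbert functions -/

theorem hilbertFunction_add_finrank (I : Ideal S) (t : ℕ) :
    hilbertFunction I t +
      Module.finrank ℂ ↥(homogeneousSubmodule (Fin 3) ℂ t ⊓ I.restrictScalars ℂ) =
      Module.finrank ℂ (homogeneousSubmodule (Fin 3) ℂ t) := by
  rw [← Submodule.map_comap_subtype, Submodule.finrank_map_subtype_eq]
  exact Submodule.finrank_quotient_add_finrank _

theorem two_mul_finrank_homogeneousSubmodule_three (n : ℕ) :
    2 * Module.finrank ℂ (homogeneousSubmodule (Fin 3) ℂ n) = (n + 1) * (n + 2) := by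
  rw [finrank_homogeneousSubmodule, Fintype.card_fin, show 3 + n - 1 = n + 2 by omega,
    Nat.choose_symm_add, mul_comm, Nat.choose_two_right, Nat.div_mul_cancel]
  · rw [show n + 2 - 1 = n + 1 by omega, mul_comm]
  · exact (Nat.even_mul_pred_self _).two_dvd

/-- The Hilbert function of a complete intersection of degrees `a` and `b`, computed from its
Koszul resolution. -/
theorem hasDegree_span_pair {p q : S} {a b : ℕ} (ha : 1 ≤ a) (hp : p.IsHomogeneous a)
    (hb : 1 ≤ b) (hq : q.IsHomogeneous b) (h : IsRelPrime p q) :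
    HasDegree (Ideal.span {p, q}) (a * b) := by
  filter_upwards [Filter.eventually_ge_atTop (a + b)] with t ht
  obtain ⟨n, rfl⟩ := Nat.exists_eq_add_of_le ht
  have hp0 := ne_zero_of_isRelPrime hb hq h.symm
  have hq0 := ne_zero_of_isRelPrime ha hp h
  let F := formPairing p q (b + n) (a + n)
  let G : homogeneousSubmodule (Fin 3) ℂ n →ₗ[ℂ]
      homogeneousSubmodule (Fin 3) ℂ (b + n) × homogeneousSubmodule (Fin 3) ℂ (a + n) :=
    (((LinearMap.mulLeft ℂ q).comp (Submodule.subtype _)).codRestrict _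
        fun x => IsHomogeneous.mul hq x.2).prod
      (((LinearMap.mulLeft ℂ (-p)).comp (Submodule.subtype _)).codRestrict _
        fun x => IsHomogeneous.mul hp.neg x.2)
  have hGinj : Function.Injective G := by
    rw [← LinearMap.ker_eq_bot, LinearMap.ker_eq_bot']
    intro x hx
    have h1 : q * (x : S) = 0 := congrArg (fun y => (y.1 : S)) hx
    exact Subtype.ext ((mul_eq_zero.1 h1).resolve_left hq0)
  -- the syzygies of `p` and `q` are the multiples of the Koszul syzygy `(q, -p)`
  have hker : LinearMap.ker F = LinearMap.range G := by
    apply le_antisymm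
    · rintro ⟨⟨α, hα⟩, ⟨β, hβ⟩⟩ hx
      have hx' : α * p + β * q = 0 := hx
      have hdvd : q ∣ α * p := ⟨-β, by linear_combination hx'⟩
      obtain ⟨γ, hγ⟩ := h.symm.dvd_of_dvd_mul_right hdvd
      have hγ' : α = q * homogeneousComponent n γ := by
        rw [← homogeneousComponent_mul_of_isHomogeneous hq, ← hγ, homogeneousComponent_eq_self hα]
      have hβ' : β = -p * homogeneousComponent n γ := by
        apply mul_right_cancel₀ hq0
        rw [hγ'] at hx'
        linear_combination hx'
      exact ⟨⟨_, homogeneousComponent_mem n γ⟩,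
        Prod.ext (Subtype.ext hγ'.symm) (Subtype.ext hβ'.symm)⟩
    · rintro _ ⟨x, rfl⟩
      change q * (x : S) * p + -p * (x : S) * q = 0
      ring
  have hrange : homogeneousSubmodule (Fin 3) ℂ (a + b + n) ⊓
      (Ideal.span {p, q}).restrictScalars ℂ = LinearMap.range F := by
    apply le_antisymm
    · rintro x ⟨hx, hxI⟩
      obtain ⟨u, v, rfl⟩ := Ideal.mem_span_pair.1 (show x ∈ Ideal.span {p, q} from hxI)
      refine ⟨(⟨_, homogeneousComponent_mem (b + n) u⟩,
        ⟨_, homogeneousComponent_mem (a + n) v⟩), ?_⟩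
      rw [← homogeneousComponent_eq_self hx, map_add]
      conv_rhs =>
        congr
        · rw [mul_comm, add_assoc, homogeneousComponent_mul_of_isHomogeneous hp, mul_comm]
        · rw [mul_comm, show a + b + n = b + (a + n) by ring,
            homogeneousComponent_mul_of_isHomogeneous hq, mul_comm]
      rfl
    · rintro _ ⟨⟨⟨u, hu⟩, ⟨v, hv⟩⟩, rfl⟩
      refine ⟨?_, Ideal.mem_span_pair.2 ⟨u, v, rfl⟩⟩
      change u * p + v * q ∈ _
      refine add_mem ?_ ?_
      · rw [show a + b + n = b + n + a by ring]; exact IsHomogeneous.mul hu hp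
      · rw [show a + b + n = a + n + b by ring]; exact IsHomogeneous.mul hv hq
  have h1 := hilbertFunction_add_finrank (Ideal.span {p, q}) (a + b + n)
  rw [hrange] at h1
  have h2 := LinearMap.finrank_range_add_finrank_ker F
  rw [hker, LinearMap.finrank_range_of_inj hGinj, Module.finrank_prod] at h2
  have d1 := two_mul_finrank_homogeneousSubmodule_three (a + b + n)
  have d2 := two_mul_finrank_homogeneousSubmodule_three (a + n)
  have d3 := two_mul_finrank_homogeneousSubmodule_three (b + n)
  have d4 := two_mul_finrank_homogeneousSubmodule_three n
  zify at *
  apply mul_left_cancel₀ (two_ne_zero (α := ℤ))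
  linear_combination 2 * h1 - 2 * h2 + d1 - d2 - d3 + d4

/-- The ideal `I` is homogeneous: it contains the homogeneous components of its elements. -/
def HasComponents (I : Ideal S) : Prop :=
  ∀ g ∈ I, ∀ n, homogeneousComponent n g ∈ I

variable {I : Ideal S}

/-- Passing to the chart `l = 1` loses nothing in large degrees: a form that lies in `I + (l - 1)`
lies in `I`, if multiplication by `l` is injective modulo `I` in degrees at least `t₀`. -/
theorem mem_of_mem_sup_span_sub_one {l : S} (hl : l.IsHomogeneous 1) (hI : HasComponents I)
    {t₀ : ℕ} (hinj : ∀ t ≥ t₀, ∀ g : S, g.IsHomogeneous t → l * g ∈ I → g ∈ I)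
    {t : ℕ} (ht : t₀ ≤ t) {g : S} (hg : g.IsHomogeneous t) (h : g ∈ I ⊔ Ideal.span {l - 1}) :
    g ∈ I := by
  obtain ⟨a, ha, b, hb, rfl⟩ := Submodule.mem_sup.1 h
  obtain ⟨c, rfl⟩ := Ideal.mem_span_singleton.1 hb
  -- comparing components in degree `j`: `l c_{j-1} - c_j` lies in `I` unless `j = t`
  have hstep : ∀ j, j + 1 ≠ t →
      l * homogeneousComponent j c - homogeneousComponent (j + 1) c ∈ I := by
    intro j hj
    have h1 := homogeneousComponent_of_mem (m := j + 1) ((mem_homogeneousSubmodule _ _).2 hg)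
    rw [if_neg hj, sub_mul, one_mul, map_add, map_sub, add_comm j 1,
      homogeneousComponent_mul_of_isHomogeneous hl] at h1
    have h2 := neg_mem (hI a ha (1 + j))
    rwa [add_comm j 1, show l * homogeneousComponent j c - homogeneousComponent (1 + j) c =
      -homogeneousComponent (1 + j) a by linear_combination h1]
  have hlow : ∀ j < t, homogeneousComponent j c ∈ I := by
    intro j
    induction j with
    | zero =>
      intro hj
      have h1 := homogeneousComponent_of_mem (m := 0) ((mem_homogeneousSubmodule _ _).2 hg)
      rw [if_neg hj.ne, sub_mul, one_mul, map_add, map_sub,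
        homogeneousComponent_mul_of_lt hl _ zero_lt_one] at h1
      rw [show homogeneousComponent 0 c = homogeneousComponent 0 a by linear_combination -h1]
      exact hI a ha 0
    | succ j ih =>
      intro hj
      have := sub_mem (Ideal.mul_mem_left _ l (ih (by omega))) (hstep j hj.ne)
      rwa [sub_sub_cancel] at this
  -- descending induction from a degree in which `c` has no component
  have hhigh : ∀ n, homogeneousComponent (t + n) c ∈ I := by
    have hdesc : ∀ k n, c.totalDegree < t + n + k → homogeneousComponent (t + n) c ∈ I := by
      intro k
      induction k with
      | zero =>
        intro n hn
        rw [homogeneousComponent_eq_zero _ _ (by simpa using hn)]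
        exact zero_mem _
      | succ k ih =>
        intro n hn
        apply hinj (t + n) (by omega) _ (homogeneousComponent_isHomogeneous _ _)
        have := add_mem (hstep (t + n) (by omega)) (ih (n + 1) (by omega))
        rwa [← add_assoc t n 1, sub_add_cancel] at this
    exact fun n => hdesc (c.totalDegree + 1) n (by omega)
  have hc : c ∈ I := by
    rw [← sum_homogeneousComponent c]
    refine sum_mem fun j _ => ?_
    by_cases hj : j < t
    · exact hlow j hj
    · obtain ⟨n, rfl⟩ := Nat.exists_eq_add_of_le (not_lt.1 hj)
      exact hhigh n
  exact add_mem ha (Ideal.mul_mem_left _ _ hc)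

/-- By the Nullstellensatz, if no common zero of `I` lies on the line `l = 0`, then every form of
large degree is congruent to a multiple of `l` modulo `I`. -/
theorem exists_sub_mul_mem {l : S} (hl : l.IsHomogeneous 1) (hI : HasComponents I)
    (hV : ∀ x : Fin 3 → ℂ, x ≠ 0 → (∀ g ∈ I, eval x g = 0) → eval x l ≠ 0) :
    ∃ t₀, ∀ t ≥ t₀, ∀ g : S, g.IsHomogeneous (t + 1) →
      ∃ h : S, h.IsHomogeneous t ∧ g - l * h ∈ I := by
  set J := I ⊔ Ideal.span {l}
  have hrad : idealOfVars (Fin 3) ℂ ≤ J.radical := by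
    rw [← vanishingIdeal_zeroLocus_eq_radical (K := ℂ)]
    rw [idealOfVars, Ideal.span_le]
    rintro _ ⟨i, rfl⟩ x hx
    have hx0 : x = 0 := by
      by_contra hx0
      refine hV x hx0 (fun g hg => ?_) ?_
      · exact hx g (Submodule.mem_sup_left hg)
      · exact hx l (Submodule.mem_sup_right (Ideal.mem_span_singleton_self l))
    simp [hx0]
  obtain ⟨N, hN⟩ := Ideal.exists_pow_le_of_le_radical_of_fg hrad (idealOfVars_fg _ _)
  refine ⟨N, fun t ht g hg => ?_⟩
  have hgJ : g ∈ J := hN (Ideal.pow_le_pow_right (by omega) hg.mem_idealOfVars_pow)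
  obtain ⟨a, ha, b, hb, hab⟩ := Submodule.mem_sup.1 hgJ
  obtain ⟨c, rfl⟩ := Ideal.mem_span_singleton.1 hb
  refine ⟨homogeneousComponent t c, homogeneousComponent_isHomogeneous _ _, ?_⟩
  have := hI a ha (1 + t)
  rw [eq_sub_of_add_eq hab, map_sub, homogeneousComponent_mul_of_isHomogeneous hl, add_comm 1 t,
    homogeneousComponent_eq_self hg] at this
  exact this

/-- Where the Hilbert function of `I` is constant, multiplication by `l` is injective modulo `I` as
soon as it is surjective. -/
theorem mem_of_mul_mem_of_hilbertFunction_eq {l : S} (hl : l.IsHomogeneous 1) {t : ℕ}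
    (hfin : hilbertFunction I t = hilbertFunction I (t + 1))
    (hdiv : ∀ g : S, g.IsHomogeneous (t + 1) → ∃ h : S, h.IsHomogeneous t ∧ g - l * h ∈ I)
    {g : S} (hg : g.IsHomogeneous t) (hlg : l * g ∈ I) : g ∈ I := by
  let D (t : ℕ) := homogeneousSubmodule (Fin 3) ℂ t
  let K (t : ℕ) : Submodule ℂ (D t) := (I.restrictScalars ℂ).comap (D t).subtype
  let M : D t →ₗ[ℂ] D (t + 1) :=
    ((LinearMap.mulRight ℂ l).comp (D t).subtype).codRestrict _
      fun x => IsHomogeneous.mul x.2 hl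
  have hM : K t ≤ (K (t + 1)).comap M := fun x hx => Ideal.mul_mem_right _ _ hx
  have hsurj : Function.Surjective ((K t).mapQ (K (t + 1)) M hM) := by
    intro y
    obtain ⟨⟨y, hy⟩, rfl⟩ := Submodule.mkQ_surjective _ y
    obtain ⟨h, hh, hy'⟩ := hdiv y hy
    refine ⟨(K t).mkQ ⟨h, hh⟩, ?_⟩
    rw [Submodule.mkQ_apply, Submodule.mapQ_apply, Submodule.mkQ_apply, eq_comm,
      Submodule.Quotient.eq]
    change y - h * l ∈ I
    rwa [mul_comm h l]
  have hi := (LinearMap.injective_iff_surjective_of_finrank_eq_finrank hfin).2 hsurj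
  have h0 : (K t).mapQ (K (t + 1)) M hM ((K t).mkQ ⟨g, hg⟩) = 0 := by
    rw [Submodule.mkQ_apply, Submodule.mapQ_apply, Submodule.Quotient.mk_eq_zero]
    change g * l ∈ I
    rwa [mul_comm g l]
  have := (map_eq_zero_iff _ hi).1 h0
  rwa [Submodule.mkQ_apply, Submodule.Quotient.mk_eq_zero] at this

/-- On the chart `l = 1`, every function is represented by a form of the fixed degree `t₀`. -/
theorem exists_isHomogeneous_sub_mem_sup {l : S} (hl : l.IsHomogeneous 1) {t₀ : ℕ}
    (hdiv : ∀ t ≥ t₀, ∀ g : S, g.IsHomogeneous (t + 1) →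
      ∃ h : S, h.IsHomogeneous t ∧ g - l * h ∈ I) {j : ℕ} {g : S} (hg : g.IsHomogeneous j) :
    ∃ h : S, h.IsHomogeneous t₀ ∧ g - h ∈ I ⊔ Ideal.span {l - 1} := by
  have hl1 : ∀ g : S, l * g - g ∈ I ⊔ Ideal.span {l - 1} := fun g =>
    Ideal.mem_sup_right (Ideal.mem_span_singleton.2 ⟨g, by ring⟩)
  rcases le_total t₀ j with h | h
  · obtain ⟨n, rfl⟩ := Nat.exists_eq_add_of_le h
    induction n generalizing g with
    | zero => exact ⟨g, hg, by simp⟩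
    | succ n ih =>
      obtain ⟨h, hh, hgh⟩ := hdiv (t₀ + n) (Nat.le_add_right _ _) g hg
      obtain ⟨h', hh', hhh'⟩ := ih hh (Nat.le_add_right _ _)
      refine ⟨h', hh', ?_⟩
      rw [show g - h' = g - l * h + (l * h - h) + (h - h') by ring]
      exact add_mem (add_mem (Ideal.mem_sup_left hgh) (hl1 h)) hhh'
  · obtain ⟨n, rfl⟩ := Nat.exists_eq_add_of_le h
    refine ⟨l ^ n * g, ?_, ?_⟩
    · have := (hl.pow n).mul hg
      rwa [one_mul, add_comm] at this
    · clear h hg hdiv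
      suffices l ^ n * g - g ∈ I ⊔ Ideal.span {l - 1} by
        rw [← neg_sub (l ^ n * g) g]
        exact neg_mem this
      induction n with
      | zero => simp
      | succ n ih =>
        rw [show l ^ (n + 1) * g - g = l * (l ^ n * g) - l ^ n * g + (l ^ n * g - g) by ring]
        exact add_mem (hl1 (l ^ n * g)) ih

/-- The degree of a finite subscheme of the plane is the dimension of the algebra of functions on
it, computed in the affine chart `l = 1` for a line `l = 0` that misses the subscheme. -/
theorem HasDegree.finrank_quotient_sup {δ : ℕ} (hδ : HasDegree I δ) {l : S}
    (hl : l.IsHomogeneous 1) (hI : HasComponents I)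
    (hV : ∀ x : Fin 3 → ℂ, x ≠ 0 → (∀ g ∈ I, eval x g = 0) → eval x l ≠ 0) :
    Module.finrank ℂ (S ⧸ (I ⊔ Ideal.span {l - 1})) = δ := by
  obtain ⟨t₁, ht₁⟩ := exists_sub_mul_mem hl hI hV
  obtain ⟨t₂, ht₂⟩ := Filter.eventually_atTop.1 hδ
  obtain ⟨t₀, h₁, h₂⟩ : ∃ t₀, t₁ ≤ t₀ ∧ t₂ ≤ t₀ := ⟨max t₁ t₂, le_max_left _ _, le_max_right _ _⟩
  have hinj : ∀ t ≥ t₀, ∀ g : S, g.IsHomogeneous t → l * g ∈ I → g ∈ I := fun t ht g =>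
    mem_of_mul_mem_of_hilbertFunction_eq hl
      ((ht₂ t (by omega)).trans (ht₂ (t + 1) (by omega)).symm) (ht₁ t (by omega))
  let F : homogeneousSubmodule (Fin 3) ℂ t₀ →ₗ[ℂ] S ⧸ (I ⊔ Ideal.span {l - 1}) :=
    (Ideal.Quotient.mkₐ ℂ _).toLinearMap.comp (Submodule.subtype _)
  have hker : LinearMap.ker F =
      (I.restrictScalars ℂ).comap (homogeneousSubmodule (Fin 3) ℂ t₀).subtype := by
    ext ⟨g, hg⟩
    rw [LinearMap.mem_ker]
    change Ideal.Quotient.mk _ g = 0 ↔ g ∈ I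
    rw [Ideal.Quotient.eq_zero_iff_mem]
    exact ⟨fun h => mem_of_mem_sup_span_sub_one hl hI hinj le_rfl hg h,
      fun h => Ideal.mem_sup_left h⟩
  have hsurj : Function.Surjective F := by
    rw [← LinearMap.range_eq_top, eq_top_iff]
    rintro x -
    obtain ⟨g, rfl⟩ := Ideal.Quotient.mk_surjective x
    rw [← sum_homogeneousComponent g, map_sum]
    refine sum_mem fun j _ => ?_
    obtain ⟨h, hh, hgh⟩ := exists_isHomogeneous_sub_mem_sup hl (fun t ht => ht₁ t (h₁.trans ht))
      (homogeneousComponent_isHomogeneous j g)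
    exact ⟨⟨h, hh⟩, ((Ideal.Quotient.mk_eq_mk_iff_sub_mem _ _).2 hgh).symm⟩
  have e := LinearMap.quotKerEquivOfSurjective F hsurj
  rw [← LinearEquiv.finrank_eq e, hker]
  exact ht₂ t₀ h₂

/-! ### Common zeros and linear forms -/

section

variable {I : Ideal S}

theorem _root_.MvPolynomial.IsHomogeneous.eval_smul {σ R : Type*} [Fintype σ] [CommSemiring R]
    {g : MvPolynomial σ R} {n : ℕ} (hg : g.IsHomogeneous n) (c : R) (x : σ → R) :
    eval (c • x) g = c ^ n * eval x g := by
  rw [eval_eq', eval_eq', Finset.mul_sum]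
  refine Finset.sum_congr rfl fun d hd => ?_
  have h1 : ∑ i, d i = n := by
    rw [← Finsupp.degree_eq_sum]
    by_contra h
    exact (mem_support_iff.1 hd) (hg.coeff_eq_zero h)
  simp only [Pi.smul_apply, smul_eq_mul, mul_pow, Finset.prod_mul_distrib,
    Finset.prod_pow_eq_pow_sum,
    h1]
  ring

theorem vanishes_mk_iff {f : S} {n : ℕ} (hf : f.IsHomogeneous n) {x : Fin 3 → ℂ} (hx : x ≠ 0) :
    Vanishes f (Projectivization.mk ℂ x hx) ↔ eval x f = 0 := by
  obtain ⟨a, ha⟩ := Projectivization.exists_smul_eq_mk_rep ℂ x hx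
  rw [Vanishes, ← ha, Units.smul_def, hf.eval_smul, mul_eq_zero, or_iff_right]
  exact pow_ne_zero _ a.ne_zero

/-- The points of the plane at which all elements of `I` vanish. -/
def zeroSet (I : Ideal S) : Set Plane := {p | ∀ g ∈ I, Vanishes g p}

theorem mk_mem_zeroSet_iff (hI : HasComponents I) {x : Fin 3 → ℂ} (hx : x ≠ 0) :
    Projectivization.mk ℂ x hx ∈ zeroSet I ↔ ∀ g ∈ I, eval x g = 0 := by
  constructor
  · intro h g hg
    rw [← sum_homogeneousComponent g, map_sum]
    exact Finset.sum_eq_zero fun i _ =>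
      (vanishes_mk_iff (homogeneousComponent_isHomogeneous i g) hx).1 (h _ (hI g hg i))
  · intro h g hg
    rw [Vanishes, ← sum_homogeneousComponent g, map_sum]
    exact Finset.sum_eq_zero fun i _ =>
      (vanishes_mk_iff (homogeneousComponent_isHomogeneous i g) hx).2 (h _ (hI g hg i))

/-- The linear form attached to a linear functional on `ℂ³`. -/
noncomputable def linearForm (f : Module.Dual ℂ (Fin 3 → ℂ)) : S :=
  ∑ i, C (f (Pi.single i 1)) * X i

theorem linearForm_isHomogeneous (f : Module.Dual ℂ (Fin 3 → ℂ)) :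
    (linearForm f).IsHomogeneous 1 :=
  IsHomogeneous.sum _ _ _ fun _ _ => isHomogeneous_C_mul_X _ _

@[simp]
theorem eval_linearForm (f : Module.Dual ℂ (Fin 3 → ℂ)) (x : Fin 3 → ℂ) :
    eval x (linearForm f) = f x := by
  conv_rhs => rw [LinearMap.pi_apply_eq_sum_univ f x]
  simp only [linearForm, map_sum, map_mul, eval_C, eval_X, smul_eq_mul]
  exact Finset.sum_congr rfl fun i _ => by
    rw [mul_comm]; congr; ext; simp [Pi.single_apply, eq_comm]

/-- Forms of degree at least the number of points separate the points: a product of linear forms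
vanishes at all points of `T` but `p`. -/
theorem exists_form_separating (T : Finset Plane) {t : ℕ} (ht : T.card ≤ t) (p : Plane) :
    ∃ g : S, g.IsHomogeneous t ∧ eval p.rep g ≠ 0 ∧
      ∀ q ∈ T, q ≠ p → eval q.rep g = 0 := by
  classical
  have hsep : ∀ q : Plane, q ≠ p → ∃ f : Module.Dual ℂ (Fin 3 → ℂ), f p.rep ≠ 0 ∧ f q.rep = 0 := by
    intro q hq
    have hnot : p.rep ∉ Submodule.span ℂ {q.rep} := by
      intro h
      obtain ⟨c, hc⟩ := Submodule.mem_span_singleton.1 h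
      apply hq
      rw [← q.mk_rep, ← p.mk_rep, eq_comm, Projectivization.mk_eq_mk_iff']
      exact ⟨c, hc⟩
    obtain ⟨f, h1, h2⟩ := Submodule.exists_le_ker_of_notMem hnot
    exact ⟨f, h1, h2 (Submodule.mem_span_singleton_self _)⟩
  choose! F hF1 hF2 using hsep
  obtain ⟨f₀, hf₀, -⟩ := Submodule.exists_le_ker_of_notMem
    (p := (⊥ : Submodule ℂ (Fin 3 → ℂ))) (v := p.rep) (by simpa using p.rep_nonzero)
  have hcard : (T.erase p).card ≤ t := (Finset.card_le_card (Finset.erase_subset _ _)).trans ht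
  refine ⟨(∏ q ∈ T.erase p, linearForm (F q)) * linearForm f₀ ^ (t - (T.erase p).card),
    ?_, ?_, ?_⟩
  · have h1 := IsHomogeneous.prod (T.erase p) (fun q => linearForm (F q)) (fun _ => 1)
      fun q _ => linearForm_isHomogeneous (F q)
    have h2 := h1.mul ((linearForm_isHomogeneous f₀).pow (t - (T.erase p).card))
    rwa [Finset.sum_const, smul_eq_mul, mul_one, one_mul, Nat.add_sub_of_le hcard] at h2
  · rw [map_mul, map_prod, map_pow]
    refine mul_ne_zero (Finset.prod_ne_zero_iff.2 fun q hq => ?_) (pow_ne_zero _ (by simpa))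
    rw [eval_linearForm]
    exact hF1 q (Finset.ne_of_mem_erase hq)
  · intro q hq hqp
    rw [map_mul, map_prod, Finset.prod_eq_zero (Finset.mem_erase.2 ⟨hqp, hq⟩), zero_mul]
    rw [eval_linearForm, hF2 q hqp]

/-- An ideal with constant Hilbert polynomial has finitely many zeros in the plane: `n` points
impose `n` independent conditions on forms of large degree. -/
theorem HasDegree.finite_zeroSet {δ : ℕ} (hδ : HasDegree I δ) : (zeroSet I).Finite := by
  classical
  by_contra hinf
  obtain ⟨T, hT, hcard⟩ := Set.Infinite.exists_subset_card_eq hinf (δ + 1)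
  obtain ⟨t, ht, htT⟩ := (hδ.and (Filter.eventually_ge_atTop T.card)).exists
  let ev : homogeneousSubmodule (Fin 3) ℂ t →ₗ[ℂ] (T → ℂ) :=
    LinearMap.pi fun p => (aeval p.1.rep).toLinearMap.comp (Submodule.subtype _)
  have hev : ∀ x p, ev x p = eval p.1.rep (x : S) := fun x p => by
    simp [ev, aeval_eq_eval]
  have hsurj : Function.Surjective ev := by
    rw [← LinearMap.range_eq_top, eq_top_iff]
    rintro y -
    rw [pi_eq_sum_univ y]
    refine sum_mem fun p _ => Submodule.smul_mem _ _ ?_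
    obtain ⟨g, hg, hgp, hgq⟩ := exists_form_separating T htT p.1
    refine ⟨(eval p.1.rep g)⁻¹ • ⟨g, hg⟩, ?_⟩
    ext q
    rw [map_smul, Pi.smul_apply, hev, smul_eq_mul]
    by_cases hpq : p = q
    · subst hpq
      simp [hgp]
    · rw [if_neg hpq]
      dsimp only
      rw [hgq q.1 q.2 (fun h => hpq (Subtype.ext h.symm)), mul_zero]
  have hle : (I.restrictScalars ℂ).comap (homogeneousSubmodule (Fin 3) ℂ t).subtype ≤
      LinearMap.ker ev := by
    intro x hx
    rw [LinearMap.mem_ker]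
    ext p
    rw [hev]
    exact hT p.2 _ hx
  have hsurj' : Function.Surjective (Submodule.liftQ _ ev hle) := fun y => by
    obtain ⟨x, rfl⟩ := hsurj y
    exact ⟨Submodule.mkQ _ x, Submodule.liftQ_apply _ _ _⟩
  have h1 := LinearMap.finrank_le_finrank_of_surjective hsurj'
  change _ ≤ hilbertFunction I t at h1
  rw [ht, Module.finrank_fintype_fun_eq_card, Fintype.card_coe] at h1
  omega

end

/-! ### Affine charts -/

/-- The affine chart `(s, t) ↦ v + s u + t w`, as a homomorphism of coordinate rings. -/
noncomputable def chart (v u w : Fin 3 → ℂ) : S →ₐ[ℂ] MvPolynomial (Fin 2) ℂ :=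
  aeval (fun i => C (v i) + C (u i) * X 0 + C (w i) * X 1)

theorem chart_X (v u w : Fin 3 → ℂ) (i : Fin 3) :
    chart v u w (X i) = C (v i) + C (u i) * X 0 + C (w i) * X 1 := by simp [chart]

theorem eval_chart (v u w : Fin 3 → ℂ) (x : Fin 2 → ℂ) (g : S) :
    eval x (chart v u w g) = eval (v + x 0 • u + x 1 • w) g := by
  have : ((aeval x : MvPolynomial (Fin 2) ℂ →ₐ[ℂ] ℂ).comp (chart v u w)) =
      aeval (v + x 0 • u + x 1 • w) := by
    ext i
    simp [chart_X, mul_comm]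
  have h := DFunLike.congr_fun this g
  simpa [aeval_eq_eval] using h

theorem mem_idealOfVars_iff_eval_zero {σ K : Type*} [Field K] (p : MvPolynomial σ K) :
    p ∈ idealOfVars σ K ↔ eval 0 p = 0 := by
  rw [← pow_one (idealOfVars σ K), mem_idealOfVars_pow_iff_homogeneousComponent]
  rw [eval_zero, constantCoeff_eq]
  simp

theorem chart_mem_idealOfVars_iff (v u w : Fin 3 → ℂ) (g : S) :
    chart v u w g ∈ idealOfVars (Fin 2) ℂ ↔ eval v g = 0 := by
  rw [mem_idealOfVars_iff_eval_zero, eval_chart]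
  simp

section Basis

variable {v u w : Fin 3 → ℂ}

theorem exists_dual_basis (h : LinearIndependent ℂ ![v, u, w]) :
    ∃ f₀ f₁ f₂ : Module.Dual ℂ (Fin 3 → ℂ),
      (f₀ v = 1 ∧ f₀ u = 0 ∧ f₀ w = 0) ∧ (f₁ v = 0 ∧ f₁ u = 1 ∧ f₁ w = 0) ∧
      (f₂ v = 0 ∧ f₂ u = 0 ∧ f₂ w = 1) ∧ ∀ x, x = f₀ x • v + f₁ x • u + f₂ x • w := by
  let b := basisOfLinearIndependentOfCardEqFinrank h (by simp)
  have hb : ⇑b = ![v, u, w] := coe_basisOfLinearIndependentOfCardEqFinrank h (by simp)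
  have h0 : b 0 = v := by rw [hb]; rfl
  have h1 : b 1 = u := by rw [hb]; rfl
  have h2 : b 2 = w := by rw [hb]; rfl
  refine ⟨b.coord 0, b.coord 1, b.coord 2, ?_, ?_, ?_, fun x => ?_⟩
  · rw [← h0, ← h1, ← h2]; simp [Module.Basis.coord_apply]
  · rw [← h0, ← h1, ← h2]; simp [Module.Basis.coord_apply]
  · rw [← h0, ← h1, ← h2]; simp [Module.Basis.coord_apply]
  · conv_lhs => rw [← b.sum_repr x]
    rw [Fin.sum_univ_three, h0, h1, h2]
    rfl

theorem chart_linearForm (f : Module.Dual ℂ (Fin 3 → ℂ)) :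
    chart v u w (linearForm f) = C (f v) + C (f u) * X 0 + C (f w) * X 1 := by
  apply MvPolynomial.funext
  intro x
  rw [eval_chart, eval_linearForm]
  simp [mul_comm]

/-- The chart is split by the homomorphism that sends the affine coordinates to the dual linear
forms; in particular its kernel is generated by `l - 1`, where `l` is the linear form that is
`1` on the image of the chart. -/
theorem chart_surjective_and_ker (h : LinearIndependent ℂ ![v, u, w]) :
    Function.Surjective (chart v u w) ∧ ∀ f : Module.Dual ℂ (Fin 3 → ℂ),
      f v = 1 → f u = 0 → f w = 0 → ∀ g, chart v u w g = 0 → g ∈ Ideal.span {linearForm f - 1} := by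
  obtain ⟨f₀, f₁, f₂, -, ⟨h10, h11, h12⟩, ⟨h20, h21, h22⟩, hx⟩ := exists_dual_basis h
  let σ : MvPolynomial (Fin 2) ℂ →ₐ[ℂ] S := aeval ![linearForm f₁, linearForm f₂]
  constructor
  · have : (chart v u w).comp σ = AlgHom.id ℂ _ := by
      ext i : 1
      fin_cases i
      · simp [σ, chart_linearForm, h10, h11, h12]
      · simp [σ, chart_linearForm, h20, h21, h22]
    exact fun y => ⟨σ y, DFunLike.congr_fun this y⟩
  · intro f hv hu hw g hg
    let π := Ideal.Quotient.mkₐ ℂ (Ideal.span {linearForm f - 1})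
    have hcomp : π.comp (σ.comp (chart v u w)) = π := by
      ext i : 1
      have h2 : (X i : S) = C (v i) * linearForm f + C (u i) * linearForm f₁ +
          C (w i) * linearForm f₂ := by
        apply MvPolynomial.funext
        intro x
        have hfx : f x = f₀ x := by
          conv_lhs => rw [hx x]
          simp [hv, hu, hw]
        have := congrFun (hx x) i
        simp only [Pi.add_apply, Pi.smul_apply, smul_eq_mul] at this
        simp only [map_add, map_mul, eval_X, eval_C, eval_linearForm, hfx]
        linear_combination this
      have h1 : σ (chart v u w (X i)) = C (v i) + C (u i) * linearForm f₁ +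
          C (w i) * linearForm f₂ := by
        simp [σ, chart_X]
      rw [AlgHom.comp_apply, AlgHom.comp_apply, h1]
      change Ideal.Quotient.mk _ _ = Ideal.Quotient.mk _ _
      rw [Ideal.Quotient.mk_eq_mk_iff_sub_mem, h2]
      exact Ideal.mem_span_singleton.2 ⟨-C (v i), by ring⟩
    have := DFunLike.congr_fun hcomp g
    rw [AlgHom.comp_apply, AlgHom.comp_apply, hg, map_zero, map_zero] at this
    exact Ideal.Quotient.eq_zero_iff_mem.1 this.symm

theorem exists_linearIndependent_of_dual {f : Module.Dual ℂ (Fin 3 → ℂ)} {v : Fin 3 → ℂ}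
    (hv : f v ≠ 0) : ∃ u w, f u = 0 ∧ f w = 0 ∧ LinearIndependent ℂ ![v, u, w] := by
  have hf : f ≠ 0 := fun h => hv (by simp [h])
  have h2 : Module.finrank ℂ (LinearMap.ker f) = 2 := by
    have := Module.Dual.finrank_ker_add_one_of_ne_zero hf
    rw [Module.finrank_fin_fun] at this
    omega
  let b := Module.finBasisOfFinrankEq ℂ (LinearMap.ker f) h2
  refine ⟨b 0, b 1, (b 0).2, (b 1).2, ?_⟩
  refine linearIndependent_finCons.2 ⟨?_, fun hmem => hv ?_⟩
  · have := b.linearIndependent.map' (LinearMap.ker f).subtype (by simp)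
    have hb : ![((b 0 : LinearMap.ker f) : Fin 3 → ℂ), b 1] = (LinearMap.ker f).subtype ∘ b := by
      ext i : 1
      fin_cases i <;> rfl
    rw [hb]
    exact this
  · have hle : Submodule.span ℂ (Set.range ![((b 0 : LinearMap.ker f) : Fin 3 → ℂ), b 1]) ≤
        LinearMap.ker f := by
      rw [Submodule.span_le]
      rintro _ ⟨i, rfl⟩
      fin_cases i
      · exact (b 0).2
      · exact (b 1).2
    exact hle hmem

end Basis

/-! ### The degree as a sum of local contributions -/

/-- Chinese remainder theorem for an ideal with finitely many zeros, in the form used for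
dimension counts: the ideals `K i` agree with `I` near the maximal ideals `m i`. -/
theorem finrank_quotient_eq_sum {R ι : Type*} [CommRing R] [Algebra ℂ R] [Fintype ι] (I : Ideal R)
    (m K : ι → Ideal R) (N : ι → ℕ) [hm : ∀ i, (m i).IsMaximal] (hinj : Function.Injective m)
    (hmK : ∀ i, m i ^ N i ≤ K i) (hIK : ∀ i, I ≤ K i)
    (hu : ∀ i, ∃ r, r ∉ m i ∧ ∀ x ∈ K i, r * x ∈ I)
    (hmax : ∀ M : Ideal R, M.IsMaximal → I ≤ M → ∃ i, M = m i)
    (hfin : ∀ i, Module.Finite ℂ (R ⧸ K i)) :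
    Module.finrank ℂ (R ⧸ I) = ∑ i, Module.finrank ℂ (R ⧸ K i) := by
  have hcop : Pairwise (Function.onFun IsCoprime K) := by
    intro i j hij
    have h1 : IsCoprime (m i) (m j) := Ideal.isCoprime_of_isMaximal (hinj.ne hij)
    have h2 := h1.pow (m := N i) (n := N j)
    rw [Ideal.isCoprime_iff_sup_eq] at h2
    rw [Function.onFun, Ideal.isCoprime_iff_sup_eq, eq_top_iff, ← h2]
    exact sup_le_sup (hmK i) (hmK j)
  have hI : I = ⨅ i, K i := by
    apply le_antisymm (le_iInf hIK)
    -- the ideal of multipliers from the intersection into `I` lies in no maximal ideal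
    have htop : Submodule.colon I ((⨅ i, K i : Ideal R) : Set R) = ⊤ := by
      by_contra hne
      obtain ⟨M, hM, hle⟩ := Ideal.exists_le_maximal _ hne
      have hIM : I ≤ M := fun x hx => hle (Submodule.mem_colon.2 fun y _ =>
        Ideal.mul_mem_right _ _ hx)
      obtain ⟨i, rfl⟩ := hmax M hM hIM
      obtain ⟨r, hr, hrK⟩ := hu i
      exact hr (hle (Submodule.mem_colon.2 fun y hy => hrK y ((Ideal.mem_iInf.1 hy) i)))
    intro x hx
    have := Submodule.mem_colon.1 (htop ▸ Submodule.mem_top : (1 : R) ∈ _) x hx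
    simpa using this
  let F : R →ₗ[ℂ] ((i : ι) → R ⧸ K i) :=
    LinearMap.pi fun i => (Ideal.Quotient.mkₐ ℂ (K i)).toLinearMap
  have hsurj : Function.Surjective F := fun y => by
    obtain ⟨x, hx⟩ := Ideal.quotientInfToPiQuotient_surj hcop y
    obtain ⟨x, rfl⟩ := Ideal.Quotient.mk_surjective x
    exact ⟨x, hx⟩
  have hker : LinearMap.ker F = I.restrictScalars ℂ := by
    ext x
    rw [LinearMap.mem_ker, Submodule.restrictScalars_mem, hI, Ideal.mem_iInf, funext_iff]
    exact forall_congr' fun i => Ideal.Quotient.eq_zero_iff_mem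
  rw [← Module.finrank_pi_fintype,
    ← LinearEquiv.finrank_eq (LinearMap.quotKerEquivOfSurjective F hsurj), hker]
  exact (LinearEquiv.finrank_eq (Submodule.Quotient.restrictScalarsEquiv ℂ I)).symm

/-- The scheme defined by `I` has multiplicity `μ` at the point `[v]`. The local ring at the origin
of the chart is replaced by the quotient by `Q + m ^ N`, where `Q` is the dehomogenization of `I`
and `N` is so large that `Q` contains `m ^ N` near the origin. -/
def HasMultiplicity (I : Ideal S) (v u w : Fin 3 → ℂ) (μ : ℕ) : Prop :=
  ∃ N, Module.finrank ℂ (MvPolynomial (Fin 2) ℂ ⧸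
      (I.map (chart v u w) ⊔ idealOfVars (Fin 2) ℂ ^ N)) = μ ∧
    ∃ r, r ∉ idealOfVars (Fin 2) ℂ ∧ ∀ x ∈ idealOfVars (Fin 2) ℂ ^ N, r * x ∈ I.map (chart v u w)

/-- The degree of a finite subscheme of the plane is the sum of its local multiplicities. -/
theorem HasDegree.eq_sum {I : Ideal S} {δ : ℕ} (hδ : HasDegree I δ) (hI : HasComponents I)
    (μ : Plane → ℕ)
    (hloc : ∀ (v : Fin 3 → ℂ) (hv : v ≠ 0), (∀ g ∈ I, eval v g = 0) →
      ∀ u w, LinearIndependent ℂ ![v, u, w] →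
        HasMultiplicity I v u w (μ (Projectivization.mk ℂ v hv))) :
    δ = ∑ p ∈ hδ.finite_zeroSet.toFinset, μ p := by
  classical
  set T := hδ.finite_zeroSet.toFinset
  have hT : ∀ p : Plane, p ∈ T ↔ p ∈ zeroSet I := fun p => Set.Finite.mem_toFinset _
  -- a line that misses all zeros of `I`
  obtain ⟨f, hf⟩ := Module.exists_dual_forall_apply_ne_zero (K := ℂ) (fun p : T => p.1.rep)
    fun p => p.1.rep_nonzero
  let x : T → Fin 3 → ℂ := fun p => (f p.1.rep)⁻¹ • p.1.rep
  have hfx : ∀ p, f (x p) = 1 := fun p => by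
    rw [map_smul, smul_eq_mul, inv_mul_cancel₀ (hf p)]
  have hx0 : ∀ p, x p ≠ 0 := fun p h => by simpa [h] using hfx p
  have hmk : ∀ p, Projectivization.mk ℂ (x p) (hx0 p) = p.1 := fun p => by
    conv_rhs => rw [← p.1.mk_rep]
    rw [Projectivization.mk_eq_mk_iff']
    exact ⟨_, rfl⟩
  have hzero : ∀ p, ∀ g ∈ I, eval (x p) g = 0 := fun p => by
    rw [← mk_mem_zeroSet_iff hI (hx0 p), hmk]
    exact (hT _).1 p.2
  have hall : ∀ y : Fin 3 → ℂ, y ≠ 0 → (∀ g ∈ I, eval y g = 0) →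
      ∃ p : T, ∃ c : ℂ, c ≠ 0 ∧ y = c • x p := by
    intro y hy h
    have hmem := (mk_mem_zeroSet_iff hI hy).2 h
    refine ⟨⟨_, (hT _).2 hmem⟩, ?_⟩
    set p : T := ⟨_, (hT _).2 hmem⟩
    have := hmk p
    rw [eq_comm, Projectivization.mk_eq_mk_iff] at this
    obtain ⟨c, hc⟩ := this
    exact ⟨c, c.ne_zero, hc.symm⟩
  have hV : ∀ y : Fin 3 → ℂ, y ≠ 0 → (∀ g ∈ I, eval y g = 0) → eval y (linearForm f) ≠ 0 := by
    intro y hy h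
    obtain ⟨p, c, hc, rfl⟩ := hall y hy h
    rw [eval_linearForm, map_smul, hfx, smul_eq_mul, mul_one]
    exact hc
  rw [← hδ.finrank_quotient_sup (linearForm_isHomogeneous f) hI hV]
  set I' := I ⊔ Ideal.span {linearForm f - 1}
  have hbasis : ∀ p : T, ∃ u w, f u = 0 ∧ f w = 0 ∧ LinearIndependent ℂ ![x p, u, w] := fun p =>
    exists_linearIndependent_of_dual (by rw [hfx]; exact one_ne_zero)
  choose u w hu hw hli using hbasis
  choose N hN r hr hrN using fun p : T => hloc (x p) (hx0 p) (hzero p) (u p) (w p) (hli p)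
  let φ := fun p : T => chart (x p) (u p) (w p)
  have hφs : ∀ p, Function.Surjective (φ p) := fun p => (chart_surjective_and_ker (hli p)).1
  have hφk : ∀ p g, φ p g = 0 → g ∈ I' := fun p g hg => Ideal.mem_sup_right
    ((chart_surjective_and_ker (hli p)).2 f (hfx p) (hu p) (hw p) g hg)
  let K := fun p : T => (I.map (φ p) ⊔ idealOfVars (Fin 2) ℂ ^ N p).comap (φ p)
  have hIK : ∀ p, I' ≤ K p := by
    intro p
    refine sup_le (fun g hg => Ideal.mem_sup_left (Ideal.mem_map_of_mem _ hg)) ?_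
    rw [Ideal.span_le, Set.singleton_subset_iff]
    have : φ p (linearForm f - 1) = 0 := by
      simp [φ, chart_linearForm, hfx, hu, hw]
    change φ p (linearForm f - 1) ∈ I.map (φ p) ⊔ idealOfVars (Fin 2) ℂ ^ N p
    rw [this]
    exact zero_mem _
  have hquot : ∀ p, Nonempty ((S ⧸ K p) ≃ₐ[ℂ] (MvPolynomial (Fin 2) ℂ ⧸
      (I.map (φ p) ⊔ idealOfVars (Fin 2) ℂ ^ N p))) := fun p => by
    have hs := (Ideal.Quotient.mkₐ_surjective ℂ
      (I.map (φ p) ⊔ idealOfVars (Fin 2) ℂ ^ N p)).comp (hφs p)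
    refine ⟨(Ideal.quotientEquivAlgOfEq ℂ ?_).trans
      (Ideal.quotientKerAlgEquivOfSurjective (f := (Ideal.Quotient.mkₐ ℂ _).comp (φ p)) hs)⟩
    ext g
    change φ p g ∈ I.map (φ p) ⊔ idealOfVars (Fin 2) ℂ ^ N p ↔ Ideal.Quotient.mk _ (φ p g) = 0
    exact Ideal.Quotient.eq_zero_iff_mem.symm
  rw [finrank_quotient_eq_sum I' (fun p : T => vanishingIdeal ℂ {x p}) K N,
    ← Finset.sum_coe_sort T μ]
  · refine Finset.sum_congr rfl fun p _ => ?_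
    obtain ⟨e⟩ := hquot p
    rw [LinearEquiv.finrank_eq e.toLinearEquiv, ← hmk p]
    exact hN p
  · intro p q hpq
    dsimp only at hpq
    have hmem : ∀ i, (X i - C (x p i) : S) ∈ vanishingIdeal ℂ {x q} := fun i => by
      rw [← hpq, mem_vanishingIdeal_singleton_iff]
      simp
    have hxpq : x p = x q := by
      ext i
      have := hmem i
      rw [mem_vanishingIdeal_singleton_iff] at this
      simp only [map_sub, aeval_X, aeval_C, Algebra.algebraMap_self, RingHom.id_apply] at this
      exact (sub_eq_zero.1 this).symm
    apply Subtype.ext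
    rw [← hmk p, ← hmk q]
    congr 1
  · intro p
    rw [← Ideal.map_le_iff_le_comap, Ideal.map_pow]
    refine le_trans (Ideal.pow_right_mono ?_ _) le_sup_right
    rw [Ideal.map_le_iff_le_comap]
    intro g hg
    rw [mem_vanishingIdeal_singleton_iff, aeval_eq_eval] at hg
    exact (chart_mem_idealOfVars_iff _ _ _ _).2 hg
  · exact hIK
  · intro p
    obtain ⟨s, hs⟩ := hφs p (r p)
    refine ⟨s, fun hmem => hr p ?_, fun g hg => ?_⟩
    · rw [← hs]
      rw [mem_vanishingIdeal_singleton_iff, aeval_eq_eval] at hmem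
      exact (chart_mem_idealOfVars_iff _ _ _ _).2 hmem
    · obtain ⟨a, ha, b, hb, hab⟩ := Submodule.mem_sup.1 (show φ p g ∈ _ from hg)
      have h1 : φ p (s * g) ∈ I.map (φ p) := by
        rw [map_mul, hs, ← hab, mul_add]
        exact add_mem (Ideal.mul_mem_left _ _ ha) (hrN p b hb)
      obtain ⟨c, hc, hcg⟩ := (Ideal.mem_map_iff_of_surjective _ (hφs p)).1 h1
      have h2 := hφk p (s * g - c) (by rw [map_sub, hcg, sub_self])
      rw [← sub_add_cancel (s * g) c]
      exact add_mem h2 (Ideal.mem_sup_left hc)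
  · intro M hM hle
    obtain ⟨y, rfl⟩ := isMaximal_iff_eq_vanishingIdeal_singleton.1 hM
    have hyI : ∀ g ∈ I', eval y g = 0 := fun g hg => by
      have := hle hg
      rwa [mem_vanishingIdeal_singleton_iff, aeval_eq_eval] at this
    have hfy : f y = 1 := by
      have := hyI _ (Ideal.mem_sup_right (Ideal.mem_span_singleton_self _))
      rw [map_sub, eval_linearForm, map_one] at this
      exact sub_eq_zero.1 this
    have hy0 : y ≠ 0 := fun h => by simp [h] at hfy
    obtain ⟨p, c, hc, rfl⟩ := hall y hy0 fun g hg => hyI g (Ideal.mem_sup_left hg)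
    rw [map_smul, hfx, smul_eq_mul, mul_one] at hfy
    exact ⟨p, by rw [hfy, one_smul]⟩
  · intro p
    obtain ⟨e⟩ := hquot p
    have := (finite_finrank_quotient_add (N := N p)
      (I := I.map (φ p) ⊔ idealOfVars (Fin 2) ℂ ^ N p) le_sup_right).1
    exact Module.Finite.equiv e.symm.toLinearEquiv

/-! ### Partial derivatives and tangent cones -/

section Derivatives

theorem homogeneousComponent_pderiv {σ R : Type*} [CommSemiring R] (n : ℕ) (i : σ)
    (g : MvPolynomial σ R) :
    homogeneousComponent n (pderiv i g) = pderiv i (homogeneousComponent (n + 1) g) := by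
  ext d
  rw [coeff_homogeneousComponent, coeff_pderiv, coeff_pderiv, coeff_homogeneousComponent,
    map_add, Finsupp.degree_single]
  by_cases h : d.degree = n
  · rw [if_pos h, if_pos (by omega)]
  · rw [if_neg h, if_neg (by omega), zero_mul]

theorem pderiv_mem_idealOfVars_pow {σ R : Type*} [CommRing R] {n : ℕ} (i : σ)
    {g : MvPolynomial σ R} (hg : g ∈ idealOfVars σ R ^ (n + 1)) :
    pderiv i g ∈ idealOfVars σ R ^ n := by
  rw [mem_idealOfVars_pow_iff_homogeneousComponent] at hg ⊢
  intro j hj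
  rw [homogeneousComponent_pderiv, hg _ (by omega), map_zero]

variable {K : Type*} [Field K]

theorem X_mem_idealOfVars {σ R : Type*} [CommRing R] (i : σ) :
    (X i : MvPolynomial σ R) ∈ idealOfVars σ R :=
  Ideal.subset_span ⟨i, rfl⟩

theorem homogeneousComponent_one_eq (g : MvPolynomial (Fin 2) K) :
    homogeneousComponent 1 g =
      C (eval 0 (pderiv 0 g)) * X 0 + C (eval 0 (pderiv 1 g)) * X 1 := by
  have h := (homogeneousComponent_isHomogeneous 1 g).sum_X_mul_pderiv
  rw [Fin.sum_univ_two, one_smul, ← homogeneousComponent_pderiv 0, ← homogeneousComponent_pderiv 0,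
    homogeneousComponent_zero, homogeneousComponent_zero] at h
  rw [eval_zero, constantCoeff_eq, ← h]
  ring

theorem coeff_zero_of_forall_pderiv_eq_zero {σ : Type*} [CharZero K] {p : MvPolynomial σ K}
    (h : ∀ i, pderiv i p = 0) : p = C (coeff 0 p) := by
  classical
  ext d
  rw [coeff_C]
  split_ifs with hd
  · rw [hd]
  · obtain ⟨i, hi⟩ := Finsupp.ne_iff.1 (Ne.symm hd)
    have hi' : 1 ≤ d i := Nat.one_le_iff_ne_zero.2 hi
    have h1 := coeff_pderiv (i := i) p (d - Finsupp.single i 1)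
    rw [h i, coeff_zero, tsub_add_cancel_of_le (by simpa using hi')] at h1
    exact (mul_eq_zero.1 h1.symm).resolve_right (by norm_cast)

theorem totalDegree_pderiv_lt {σ : Type*} {p : MvPolynomial σ K} {i : σ} (h : pderiv i p ≠ 0) :
    (pderiv i p).totalDegree < p.totalDegree := by
  by_contra hle
  obtain ⟨d, hd, hdeg⟩ := Finset.exists_mem_eq_sup _ (support_nonempty.2 h)
    fun d => d.sum fun _ e => e
  rw [mem_support_iff, coeff_pderiv] at hd
  have h1 := le_totalDegree (mem_support_iff.2 (left_ne_zero_of_mul hd))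
  rw [Finsupp.sum_add_index' (fun _ => rfl) (fun _ _ _ => rfl), Finsupp.sum_single_index rfl] at h1
  have h2 : (pderiv i p).totalDegree = d.sum fun _ e => e := hdeg
  omega

/-- The partial derivatives of a squarefree binary form have no common factor: by Euler's identity,
a common irreducible factor would divide the form, hence its own derivatives. -/
theorem isRelPrime_pderiv_of_squarefree [CharZero K] {G : MvPolynomial (Fin 2) K} {r : ℕ}
    (hr : 1 ≤ r) (hG : G.IsHomogeneous r) (hsq : Squarefree G) :
    IsRelPrime (pderiv 0 G) (pderiv 1 G) := by
  have hr0 : (r : K) ≠ 0 := by exact_mod_cast (by omega : r ≠ 0)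
  have heuler : G = C (r : K)⁻¹ * (X 0 * pderiv 0 G + X 1 * pderiv 1 G) := by
    have := hG.sum_X_mul_pderiv
    rw [Fin.sum_univ_two] at this
    rw [this, nsmul_eq_mul, ← C_eq_coe_nat, ← mul_assoc, ← C_mul, inv_mul_cancel₀ hr0, C_1, one_mul]
  apply WfDvdMonoid.isRelPrime_of_no_irreducible_factors
  · rintro ⟨h0, h1⟩
    rw [h0, h1] at heuler
    exact hsq.ne_zero (by simpa using heuler)
  · intro p hp h0 h1
    have hdvd : p ∣ G := by
      rw [heuler]
      exact dvd_mul_of_dvd_right (dvd_add (dvd_mul_of_dvd_right h0 _) (dvd_mul_of_dvd_right h1 _)) _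
    obtain ⟨H, rfl⟩ := hdvd
    have hpH : ¬ p ∣ H := fun ⟨c, hc⟩ => hp.not_isUnit (hsq p ⟨c, by rw [hc]; ring⟩)
    have hder : ∀ i : Fin 2, p ∣ pderiv i (p * H) → pderiv i p = 0 := by
      intro i hi
      rw [Derivation.leibniz, smul_eq_mul, smul_eq_mul, dvd_add_right (dvd_mul_right _ _)] at hi
      by_contra hne
      have h2 := totalDegree_le_of_dvd_of_isDomain ((hp.prime.dvd_or_dvd hi).resolve_left hpH) hne
      have h3 := totalDegree_pderiv_lt hne
      omega
    have hC := coeff_zero_of_forall_pderiv_eq_zero (p := p) fun i => by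
      fin_cases i
      · exact hder 0 h0
      · exact hder 1 h1
    apply hp.not_isUnit
    rw [hC] at hp ⊢
    exact (isUnit_iff_ne_zero.2 fun h => hp.ne_zero (by rw [h, C_0])).map C

/-- A germ of multiplicity `r ≤ 4` belongs to the ideal generated by its derivatives, up to
`m ^ (2 r - 3)`. The bound on `r` ensures that the error in Euler's identity, which lies in
`m ^ (r + 1)`, lies in this power. -/
theorem mem_span_pderiv_sup [CharZero K] {g : MvPolynomial (Fin 2) K} {r e : ℕ} (hr : r = e + 2)
    (he : e ≤ 2) (hg : g ∈ idealOfVars (Fin 2) K ^ r) :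
    g ∈ Ideal.span {pderiv 0 g, pderiv 1 g} ⊔ idealOfVars (Fin 2) K ^ (2 * e + 1) := by
  have hr0 : (r : K) ≠ 0 := by exact_mod_cast (by omega : r ≠ 0)
  have hX : ∀ i : Fin 2, (X i : MvPolynomial (Fin 2) K) ∈ idealOfVars (Fin 2) K ^ 1 := fun i => by
    rw [pow_one]; exact X_mem_idealOfVars i
  have hr' : r = 1 + (e + 1) := by omega
  have hdg : ∀ i : Fin 2, pderiv i g ∈ idealOfVars (Fin 2) K ^ (e + 1) := fun i =>
    pderiv_mem_idealOfVars_pow i (by rwa [show e + 1 + 1 = r by omega])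
  have hXd : ∀ i : Fin 2, X i * pderiv i g ∈ idealOfVars (Fin 2) K ^ r := fun i => by
    rw [hr', pow_add]
    exact Ideal.mul_mem_mul (hX i) (hdg i)
  have hcomp : ∀ i : Fin 2, homogeneousComponent r (X i * pderiv i g) =
      X i * pderiv i (homogeneousComponent r g) := fun i => by
    have := homogeneousComponent_add_mul (hX i) (hdg i)
    rwa [homogeneousComponent_eq_self (isHomogeneous_X K i), ← hr', homogeneousComponent_pderiv,
      show e + 1 + 1 = r by omega] at this
  -- Euler's identity holds for the tangent cone, hence for `g` up to higher order
  have hlow : C (r : K) * g - (X 0 * pderiv 0 g + X 1 * pderiv 1 g) ∈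
      idealOfVars (Fin 2) K ^ (2 * e + 1) := by
    have h1 : C (r : K) * g - (X 0 * pderiv 0 g + X 1 * pderiv 1 g) ∈ idealOfVars (Fin 2) K ^ r :=
      sub_mem (Ideal.mul_mem_left _ _ hg) (add_mem (hXd 0) (hXd 1))
    have h2 := sub_homogeneousComponent_mem h1
    have h3 := (homogeneousComponent_isHomogeneous r g).sum_X_mul_pderiv
    rw [Fin.sum_univ_two, nsmul_eq_mul, ← C_eq_coe_nat] at h3
    rw [map_sub, homogeneousComponent_C_mul, map_add, hcomp, hcomp, h3, sub_self, sub_zero] at h2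
    exact Ideal.pow_le_pow_right (by omega) h2
  have hgeq : g = C (r : K)⁻¹ * ((C (r : K) * g - (X 0 * pderiv 0 g + X 1 * pderiv 1 g)) +
      (X 0 * pderiv 0 g + X 1 * pderiv 1 g)) := by
    rw [sub_add_cancel, ← mul_assoc, ← C_mul, inv_mul_cancel₀ hr0, C_1, one_mul]
  have hmem : X 0 * pderiv 0 g + X 1 * pderiv 1 g ∈ Ideal.span {pderiv 0 g, pderiv 1 g} :=
    Ideal.mem_span_pair.2 ⟨X 0, X 1, rfl⟩
  have := Ideal.mul_mem_left (Ideal.span {pderiv 0 g, pderiv 1 g} ⊔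
    idealOfVars (Fin 2) K ^ (2 * e + 1)) (C (r : K)⁻¹)
    (add_mem (Ideal.mem_sup_right hlow) (Ideal.mem_sup_left hmem))
  rwa [← hgeq] at this

/-- The chain rule for polynomial substitutions. -/
theorem derivation_algHom_apply {σ R A : Type*} [Fintype σ] [CommRing R] [CommRing A] [Algebra R A]
    (D : Derivation R A A) (φ : MvPolynomial σ R →ₐ[R] A) (f : MvPolynomial σ R) :
    D (φ f) = ∑ i, D (φ (X i)) * φ (pderiv i f) := by
  classical
  induction f using MvPolynomial.induction_on with
  | C a =>
    rw [← algebraMap_eq, AlgHom.commutes, Derivation.map_algebraMap]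
    simp
  | add p q hp hq =>
    simp only [map_add, mul_add, Finset.sum_add_distrib, hp, hq]
  | mul_X p j hp =>
    have h : ∀ i, D (φ (X i)) * φ (pderiv i (p * X j)) =
        (if i = j then φ p * D (φ (X i)) else 0) + φ (X j) * (D (φ (X i)) * φ (pderiv i p)) := by
      intro i
      rw [Derivation.leibniz, pderiv_X, Pi.single_apply]
      by_cases hij : i = j
      · rw [if_pos hij, if_pos hij.symm, smul_eq_mul, smul_eq_mul, map_add, map_mul, map_mul,
          map_one]
        ring
      · rw [if_neg hij, if_neg (Ne.symm hij), smul_eq_mul, smul_eq_mul, map_add, map_mul, map_mul,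
          map_zero]
        ring
    rw [Finset.sum_congr rfl fun i _ => h i, Finset.sum_add_distrib, Finset.sum_ite_eq',
      if_pos (Finset.mem_univ j), ← Finset.mul_sum, ← hp, map_mul, Derivation.leibniz, smul_eq_mul,
      smul_eq_mul]

end Derivatives

/-! ### Gradients and linear parts in a chart -/

/-- The gradient of `f` at `v`. -/
noncomputable def gradient (f : S) (v : Fin 3 → ℂ) : Fin 3 → ℂ := fun i => eval v (pderiv i f)

variable {v u w : Fin 3 → ℂ}

theorem pderiv_zero_chart (v u w : Fin 3 → ℂ) (f : S) :
    pderiv 0 (chart v u w f) = ∑ i, C (u i) * chart v u w (pderiv i f) := by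
  rw [derivation_algHom_apply]
  refine Finset.sum_congr rfl fun i _ => ?_
  rw [chart_X]
  simp [pderiv_X]

theorem pderiv_one_chart (v u w : Fin 3 → ℂ) (f : S) :
    pderiv 1 (chart v u w f) = ∑ i, C (w i) * chart v u w (pderiv i f) := by
  rw [derivation_algHom_apply]
  refine Finset.sum_congr rfl fun i _ => ?_
  rw [chart_X]
  simp [pderiv_X]

open Matrix in
theorem homogeneousComponent_one_chart (f : S) :
    homogeneousComponent 1 (chart v u w f) =
      C (gradient f v ⬝ᵥ u) * X 0 + C (gradient f v ⬝ᵥ w) * X 1 := by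
  rw [homogeneousComponent_one_eq, pderiv_zero_chart, pderiv_one_chart]
  simp only [map_sum, map_mul, eval_C, eval_chart, Pi.zero_apply, zero_smul, add_zero, dotProduct,
    gradient, mul_comm]

open Matrix in
theorem gradient_dotProduct_self {f : S} {n : ℕ} (hf : f.IsHomogeneous n) (hv : eval v f = 0) :
    gradient f v ⬝ᵥ v = 0 := by
  have := congrArg (eval v) hf.sum_X_mul_pderiv
  rw [map_sum, map_nsmul, hv, smul_zero] at this
  simpa [dotProduct, gradient, mul_comm] using this

open Matrix in
theorem eq_zero_of_dotProduct_eq_zero (h : LinearIndependent ℂ ![v, u, w]) {a : Fin 3 → ℂ}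
    (hv : a ⬝ᵥ v = 0) (hu : a ⬝ᵥ u = 0) (hw : a ⬝ᵥ w = 0) : a = 0 := by
  obtain ⟨f₀, f₁, f₂, -, -, -, hx⟩ := exists_dual_basis h
  rw [← dotProduct_eq_zero_iff]
  intro x
  rw [hx x]
  simp [hv, hu, hw]

theorem homogeneousComponent_one_chart_ne_zero (h : LinearIndependent ℂ ![v, u, w]) {f : S} {n : ℕ}
    (hf : f.IsHomogeneous n) (hv : eval v f = 0) (hg : gradient f v ≠ 0) :
    homogeneousComponent 1 (chart v u w f) ≠ 0 := by
  intro h0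
  rw [homogeneousComponent_one_chart] at h0
  have h1 := congrArg (eval ![1, 0]) h0
  have h2 := congrArg (eval ![0, 1]) h0
  simp only [map_add, map_mul, eval_C, eval_X, map_zero] at h1 h2
  exact hg (eq_zero_of_dotProduct_eq_zero h (gradient_dotProduct_self hf hv)
    (by simpa using h1) (by simpa using h2))

/-- Two curves through `[v]` have different tangents, seen in any chart, if and only if their
gradients are linearly independent. -/
theorem isRelPrime_linearPart_iff (h : LinearIndependent ℂ ![v, u, w]) {f g : S} {a b : ℕ}
    (hf : f.IsHomogeneous a) (hg : g.IsHomogeneous b) (hfv : eval v f = 0) (hgv : eval v g = 0) :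
    IsRelPrime (homogeneousComponent 1 (chart v u w f)) (homogeneousComponent 1 (chart v u w g)) ↔
      LinearIndependent ℂ ![gradient f v, gradient g v] := by
  rw [LinearIndependent.pair_iff]
  constructor
  · intro hrel s t hst
    have key : C s * homogeneousComponent 1 (chart v u w f) +
        C t * homogeneousComponent 1 (chart v u w g) = 0 := by
      rw [homogeneousComponent_one_chart, homogeneousComponent_one_chart]
      have h1 : s * (gradient f v ⬝ᵥ u) + t * (gradient g v ⬝ᵥ u) = 0 := by
        rw [← smul_eq_mul, ← smul_dotProduct, ← smul_eq_mul t, ← smul_dotProduct,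
          ← add_dotProduct, hst, zero_dotProduct]
      have h2 : s * (gradient f v ⬝ᵥ w) + t * (gradient g v ⬝ᵥ w) = 0 := by
        rw [← smul_eq_mul, ← smul_dotProduct, ← smul_eq_mul t, ← smul_dotProduct,
          ← add_dotProduct, hst, zero_dotProduct]
      have h1' := congrArg (C (σ := Fin 2)) h1
      have h2' := congrArg (C (σ := Fin 2)) h2
      simp only [map_add, map_mul, map_zero] at h1' h2'
      linear_combination X 0 * h1' + X 1 * h2'
    obtain ⟨h1, h2⟩ := eq_zero_of_mul_add_mul_eq_zero le_rfl
      (homogeneousComponent_isHomogeneous 1 _) (homogeneousComponent_isHomogeneous 1 _) hrel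
      (isHomogeneous_C _ s) zero_lt_one key
    exact ⟨C_eq_zero.1 h1, C_eq_zero.1 h2⟩
  · intro hli
    rw [homogeneousComponent_one_chart, homogeneousComponent_one_chart]
    set p := gradient f v ⬝ᵥ u
    set q := gradient f v ⬝ᵥ w
    set r := gradient g v ⬝ᵥ u
    set s := gradient g v ⬝ᵥ w
    have hcomb : ∀ x y : ℂ, x * p + y * r = 0 → x * q + y * s = 0 → x = 0 ∧ y = 0 := by
      intro x y h1 h2
      refine hli x y (eq_zero_of_dotProduct_eq_zero h ?_ ?_ ?_)
      · simp [add_dotProduct, smul_dotProduct, gradient_dotProduct_self hf hfv,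
          gradient_dotProduct_self hg hgv]
      · simpa [add_dotProduct, smul_dotProduct] using h1
      · simpa [add_dotProduct, smul_dotProduct] using h2
    have hD : p * s - q * r ≠ 0 := by
      intro hD
      obtain ⟨h1, h2⟩ := hcomb s (-q) (by linear_combination hD) (by ring)
      obtain ⟨h3, h4⟩ := hcomb r (-p) (by ring) (by linear_combination -hD)
      have := hcomb 1 0 (by linear_combination -h4) (by linear_combination -h2)
      exact one_ne_zero this.1
    have hX : IsRelPrime (X 0 : MvPolynomial (Fin 2) ℂ) (X 1) := by
      rw [(X_prime (R := ℂ) (i := (0 : Fin 2))).irreducible.isRelPrime_iff_not_dvd, X_dvd_X]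
      decide
    intro z h1 h2
    have hCD : C (p * s - q * r)⁻¹ * C (p * s - q * r) = (1 : MvPolynomial (Fin 2) ℂ) := by
      rw [← C_mul, inv_mul_cancel₀ hD, C_1]
    simp only [map_sub, map_mul] at hCD
    apply hX
    · have := dvd_mul_of_dvd_right (dvd_sub (dvd_mul_of_dvd_right h1 (C s))
        (dvd_mul_of_dvd_right h2 (C q))) (C (p * s - q * r)⁻¹)
      convert this using 1
      linear_combination -X 0 * hCD
    · have := dvd_mul_of_dvd_right (dvd_sub (dvd_mul_of_dvd_right h2 (C p))
        (dvd_mul_of_dvd_right h1 (C r))) (C (p * s - q * r)⁻¹)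
      convert this using 1
      linear_combination -X 1 * hCD

/-! ### Products of smooth curves -/

section Product

variable {ι : Type*} [Fintype ι] {c : ι → S} {n : ι → ℕ} {v u w : Fin 3 → ℂ}

/-- The indices of the curves `c i = 0` that pass through `[v]`. -/
noncomputable def through (c : ι → S) (v : Fin 3 → ℂ) : Finset ι :=
  open Classical in Finset.univ.filter fun i => eval v (c i) = 0

@[simp]
theorem mem_through {i : ι} : i ∈ through c v ↔ eval v (c i) = 0 := by
  simp [through]

/-- The tangent cone of a union of curves that are smooth at `[v]` is the union of their tangents,
so the multiplicity is the number of curves through `[v]`. -/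
theorem chart_prod_mem (hc : ∀ i, (c i).IsHomogeneous (n i))
    (hsm : ∀ i, eval v (c i) = 0 → gradient (c i) v ≠ 0) (h : LinearIndependent ℂ ![v, u, w]) :
    chart v u w (∏ i, c i) ∈ idealOfVars (Fin 2) ℂ ^ (through c v).card ∧
    homogeneousComponent (through c v).card (chart v u w (∏ i, c i)) ≠ 0 ∧
    Associated (homogeneousComponent (through c v).card (chart v u w (∏ i, c i)))
      (∏ i ∈ through c v, homogeneousComponent 1 (chart v u w (c i))) := by
  classical
  let a : ι → ℕ := fun i => if eval v (c i) = 0 then 1 else 0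
  have ha : ∑ i, a i = (through c v).card := by
    rw [through, Finset.card_filter]
  have hmem : ∀ i ∈ Finset.univ, chart v u w (c i) ∈ idealOfVars (Fin 2) ℂ ^ a i := by
    intro i _
    by_cases hi : eval v (c i) = 0
    · simp only [a, if_pos hi, pow_one]
      exact (chart_mem_idealOfVars_iff _ _ _ _).2 hi
    · simp [a, if_neg hi]
  have h1 := prod_mem_idealOfVars_pow _ _ _ hmem
  have h2 := homogeneousComponent_sum_prod _ _ _ hmem
  rw [ha, ← map_prod] at h1 h2
  have h3 : Associated (homogeneousComponent (through c v).card (chart v u w (∏ i, c i)))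
      (∏ i ∈ through c v, homogeneousComponent 1 (chart v u w (c i))) := by
    rw [h2, ← Finset.prod_filter_mul_prod_filter_not Finset.univ (fun i => eval v (c i) = 0)]
    have h4 : IsUnit (∏ i with ¬ eval v (c i) = 0,
        homogeneousComponent (a i) (chart v u w (c i))) := by
      rw [IsUnit.prod_iff]
      intro i hi
      have hi' : ¬ eval v (c i) = 0 := (Finset.mem_filter.1 hi).2
      simp only [a, if_neg hi', homogeneousComponent_zero]
      rw [← constantCoeff_eq, ← eval_zero, eval_chart]
      exact (isUnit_iff_ne_zero.2 (by simpa using hi')).map C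
    have h5 : ∏ i with eval v (c i) = 0, homogeneousComponent (a i) (chart v u w (c i)) =
        ∏ i ∈ through c v, homogeneousComponent 1 (chart v u w (c i)) := by
      refine Finset.prod_congr rfl fun i hi => ?_
      simp only [a, if_pos (mem_through.1 hi)]
    rw [h5]
    exact associated_mul_unit_left _ _ h4
  refine ⟨h1, fun h0 => ?_, h3⟩
  rw [h0] at h3
  have h6 := (associated_zero_iff_eq_zero _).1 h3.symm
  rw [Finset.prod_eq_zero_iff] at h6
  obtain ⟨i, hi, hi0⟩ := h6
  exact homogeneousComponent_one_chart_ne_zero h (hc i) (mem_through.1 hi)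
    (hsm i (mem_through.1 hi)) hi0

/-- The gradients at `v` of the curves through `[v]` are pairwise independent: any two of the
curves have different tangents there. -/
def PairwiseTransversal (c : ι → S) (v : Fin 3 → ℂ) : Prop :=
  ∀ i ∈ through c v, ∀ j ∈ through c v, i ≠ j →
    LinearIndependent ℂ ![gradient (c i) v, gradient (c j) v]

theorem squarefree_linearPart_prod_iff (hc : ∀ i, (c i).IsHomogeneous (n i))
    (hsm : ∀ i, eval v (c i) = 0 → gradient (c i) v ≠ 0) (h : LinearIndependent ℂ ![v, u, w]) :
    Squarefree (homogeneousComponent (through c v).card (chart v u w (∏ i, c i))) ↔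
      PairwiseTransversal c v := by
  classical
  rw [(chart_prod_mem hc hsm h).2.2.squarefree_iff]
  constructor
  · intro hsq i hi j hj hij
    rw [← isRelPrime_linearPart_iff h (hc i) (hc j) (mem_through.1 hi) (mem_through.1 hj)]
    apply IsRelPrime.of_squarefree_mul
    refine hsq.squarefree_of_dvd ?_
    rw [← Finset.mul_prod_erase _ _ hi, ← Finset.mul_prod_erase _ _
      (Finset.mem_erase.2 ⟨hij.symm, hj⟩), ← mul_assoc]
    exact dvd_mul_right _ _
  · intro htr
    refine Finset.squarefree_prod_of_pairwise_isCoprime (fun i hi j hj hij => ?_) fun i hi => ?_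
    · exact (isRelPrime_linearPart_iff h (hc i) (hc j) (mem_through.1 hi) (mem_through.1 hj)).2
        (htr i hi j hj hij)
    · have hne := homogeneousComponent_one_chart_ne_zero h (hc i) (mem_through.1 hi)
        (hsm i (mem_through.1 hi))
      have hdeg := (homogeneousComponent_isHomogeneous 1 (chart v u w (c i))).totalDegree hne
      rintro x ⟨y, hxy⟩
      rw [hxy] at hne hdeg
      have hx : x ≠ 0 := left_ne_zero_of_mul (left_ne_zero_of_mul hne)
      rw [totalDegree_mul_of_isDomain (left_ne_zero_of_mul hne) (right_ne_zero_of_mul hne),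
        totalDegree_mul_of_isDomain hx hx] at hdeg
      have hx0 := totalDegree_eq_zero_iff_eq_C.1 (show x.totalDegree = 0 by omega)
      rw [hx0] at hx ⊢
      exact (isUnit_iff_ne_zero.2 fun h => hx (by rw [h, C_0])).map C

/-- An ordinary point has pairwise different tangents, and its multiplicity is the number of
curves through it. -/
theorem IsOrdinaryPoint.pairwiseTransversal {p : Plane} {r : ℕ}
    (hord : IsOrdinaryPoint (∏ i, c i) p r) (hc : ∀ i, (c i).IsHomogeneous (n i))
    (hsm : ∀ i, eval p.rep (c i) = 0 → gradient (c i) p.rep ≠ 0) :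
    r = (through c p.rep).card ∧ PairwiseTransversal c p.rep := by
  obtain ⟨g, ⟨u, w, h, rfl⟩, hlow, hne, hsq⟩ := hord
  change ∀ j < r, homogeneousComponent j (chart p.rep u w (∏ i, c i)) = 0 at hlow
  change homogeneousComponent r (chart p.rep u w (∏ i, c i)) ≠ 0 at hne
  change Squarefree (homogeneousComponent r (chart p.rep u w (∏ i, c i))) at hsq
  obtain ⟨h1, h2, -⟩ := chart_prod_mem hc hsm h
  rw [mem_idealOfVars_pow_iff_homogeneousComponent] at h1
  have hr : r = (through c p.rep).card := by
    apply le_antisymm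
    · by_contra hlt
      exact h2 (hlow _ (not_le.1 hlt))
    · by_contra hlt
      exact hne (h1 _ (not_le.1 hlt))
  subst hr
  exact ⟨rfl, (squarefree_linearPart_prod_iff hc hsm h).1 hsq⟩

theorem gradient_smul {f : S} {m : ℕ} (hf : f.IsHomogeneous m) (a : ℂ) (v : Fin 3 → ℂ) :
    gradient f (a • v) = a ^ (m - 1) • gradient f v := by
  ext i
  exact hf.pderiv.eval_smul a v

theorem through_smul (hc : ∀ i, (c i).IsHomogeneous (n i)) {a : ℂ} (ha : a ≠ 0) :
    through c (a • v) = through c v := by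
  ext i
  rw [mem_through, mem_through, (hc i).eval_smul, mul_eq_zero, or_iff_right (pow_ne_zero _ ha)]

theorem PairwiseTransversal.smul (hc : ∀ i, (c i).IsHomogeneous (n i)) {a : ℂ} (ha : a ≠ 0)
    (h : PairwiseTransversal c v) : PairwiseTransversal c (a • v) := by
  intro i hi j hj hij
  rw [through_smul hc ha] at hi hj
  have h1 := LinearIndependent.pair_iff.1 (h i hi j hj hij)
  rw [gradient_smul (hc i), gradient_smul (hc j), LinearIndependent.pair_iff]
  intro s t hst
  rw [smul_smul, smul_smul] at hst
  obtain ⟨h2, h3⟩ := h1 _ _ hst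
  exact ⟨(mul_eq_zero.1 h2).resolve_right (pow_ne_zero _ ha),
    (mul_eq_zero.1 h3).resolve_right (pow_ne_zero _ ha)⟩

/-- Two transversal curves have intersection multiplicity one. -/
theorem hasMultiplicity_span_pair (h : LinearIndependent ℂ ![v, u, w]) {f g : S} {a b : ℕ}
    (hf : f.IsHomogeneous a) (hg : g.IsHomogeneous b) (hfv : eval v f = 0) (hgv : eval v g = 0)
    (hli : LinearIndependent ℂ ![gradient f v, gradient g v]) :
    HasMultiplicity (Ideal.span {f, g}) v u w 1 := by
  have hrel := (isRelPrime_linearPart_iff h hf hg hfv hgv).2 hli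
  have h1 := (chart_mem_idealOfVars_iff v u w f).2 hfv
  have h2 := (chart_mem_idealOfVars_iff v u w g).2 hgv
  rw [← pow_one (idealOfVars _ _)] at h1 h2
  have hmap : (Ideal.span {f, g}).map (chart v u w) =
      Ideal.span {chart v u w f, chart v u w g} := by
    rw [Ideal.map_span, Set.image_pair]
  rw [HasMultiplicity, hmap]
  exact ⟨2 * 0 + 1, finrank_quotient_span_pair_sup (e := 0) h1 h2 hrel,
    exists_notMem_mul_mem (e := 0) h1 h2 hrel⟩

/-- In a chart, the Jacobian ideal of `f` is contained in the ideal of the local equation and its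
two derivatives: by Euler's identity they express the derivative in the direction of `v`. -/
theorem map_jacobianIdeal_le (h : LinearIndependent ℂ ![v, u, w]) {f : S} {m : ℕ}
    (hf : f.IsHomogeneous m) {I : Ideal (MvPolynomial (Fin 2) ℂ)}
    (h0 : chart v u w f ∈ I) (h1 : pderiv 0 (chart v u w f) ∈ I)
    (h2 : pderiv 1 (chart v u w f) ∈ I) : (jacobianIdeal f).map (chart v u w) ≤ I := by
  obtain ⟨f₀, f₁, f₂, -, -, -, hx⟩ := exists_dual_basis h
  have hEuler : (∑ i, C (v i) * chart v u w (pderiv i f)) + X 0 * pderiv 0 (chart v u w f) +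
      X 1 * pderiv 1 (chart v u w f) = m • chart v u w f := by
    have := congrArg (chart v u w) hf.sum_X_mul_pderiv
    rw [map_sum, map_nsmul] at this
    rw [← this, pderiv_zero_chart, pderiv_one_chart, Finset.mul_sum, Finset.mul_sum,
      ← Finset.sum_add_distrib, ← Finset.sum_add_distrib]
    refine Finset.sum_congr rfl fun i _ => ?_
    rw [map_mul, chart_X]
    ring
  have hv : ∑ i, C (v i) * chart v u w (pderiv i f) ∈ I := by
    rw [show ∑ i, C (v i) * chart v u w (pderiv i f) = m • chart v u w f -
      X 0 * pderiv 0 (chart v u w f) - X 1 * pderiv 1 (chart v u w f) by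
        rw [← hEuler]; ring]
    exact sub_mem (sub_mem (nsmul_mem h0 _) (Ideal.mul_mem_left _ _ h1)) (Ideal.mul_mem_left _ _ h2)
  rw [pderiv_zero_chart] at h1
  rw [pderiv_one_chart] at h2
  rw [jacobianIdeal, Ideal.map_span, Ideal.span_le]
  rintro _ ⟨_, ⟨j, rfl⟩, rfl⟩
  have hj := hx (Pi.single j 1)
  have hsum : ∀ a b d : ℂ, ∑ i, C ((a • v + b • u + d • w) i) * chart v u w (pderiv i f) =
      C a * (∑ i, C (v i) * chart v u w (pderiv i f)) +
      C b * (∑ i, C (u i) * chart v u w (pderiv i f)) +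
      C d * (∑ i, C (w i) * chart v u w (pderiv i f)) := by
    intro a b d
    rw [Finset.mul_sum, Finset.mul_sum, Finset.mul_sum, ← Finset.sum_add_distrib,
      ← Finset.sum_add_distrib]
    refine Finset.sum_congr rfl fun i _ => ?_
    simp only [Pi.add_apply, Pi.smul_apply, smul_eq_mul, C_add, C_mul]
    ring
  have h3 := hsum (f₀ (Pi.single j 1)) (f₁ (Pi.single j 1)) (f₂ (Pi.single j 1))
  rw [← hj, Finset.sum_eq_single j (by intro i _ hij; simp [hij]) (by simp), Pi.single_eq_same,
    C_1, one_mul] at h3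
  change chart v u w (pderiv j f) ∈ I
  rw [h3]
  exact add_mem (add_mem (Ideal.mul_mem_left _ _ hv) (Ideal.mul_mem_left _ _ h1))
    (Ideal.mul_mem_left _ _ h2)

theorem pderiv_chart_mem_map (f : S) (v u w : Fin 3 → ℂ) :
    pderiv 0 (chart v u w f) ∈ (jacobianIdeal f).map (chart v u w) ∧
    pderiv 1 (chart v u w f) ∈ (jacobianIdeal f).map (chart v u w) := by
  rw [pderiv_zero_chart, pderiv_one_chart]
  have : ∀ i, chart v u w (pderiv i f) ∈ (jacobianIdeal f).map (chart v u w) := fun i =>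
    Ideal.mem_map_of_mem _ (Ideal.subset_span ⟨i, rfl⟩)
  exact ⟨sum_mem fun i _ => Ideal.mul_mem_left _ _ (this i),
    sum_mem fun i _ => Ideal.mul_mem_left _ _ (this i)⟩

/-- The Tjurina number of an ordinary point of multiplicity `r ≤ 4` is `(r - 1) ^ 2`. -/
theorem hasMultiplicity_jacobianIdeal (hc : ∀ i, (c i).IsHomogeneous (n i))
    (hsm : ∀ i, eval v (c i) = 0 → gradient (c i) v ≠ 0) (h : LinearIndependent ℂ ![v, u, w])
    (htr : PairwiseTransversal c v) {e : ℕ} (he : (through c v).card = e + 1 + 1) (he2 : e ≤ 2) :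
    HasMultiplicity (jacobianIdeal (∏ i, c i)) v u w ((e + 1) ^ 2) := by
  obtain ⟨hmem, -, -⟩ := chart_prod_mem hc hsm h
  have hsq := (squarefree_linearPart_prod_iff hc hsm h).2 htr
  have hf : (∏ i, c i).IsHomogeneous (∑ i, n i) := IsHomogeneous.prod _ _ _ fun i _ => hc i
  rw [he] at hmem hsq
  set f := ∏ i, c i
  set g := chart v u w f
  have hrel := isRelPrime_pderiv_of_squarefree (r := e + 1 + 1) (by omega)
    (homogeneousComponent_isHomogeneous _ g) hsq
  rw [← homogeneousComponent_pderiv (e + 1), ← homogeneousComponent_pderiv (e + 1)] at hrel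
  have h0 := pderiv_mem_idealOfVars_pow (n := e + 1) 0 hmem
  have h1 := pderiv_mem_idealOfVars_pow (n := e + 1) 1 hmem
  obtain ⟨hJ0, hJ1⟩ := pderiv_chart_mem_map f v u w
  have hle : Ideal.span {pderiv 0 g, pderiv 1 g} ≤ (jacobianIdeal f).map (chart v u w) := by
    rw [Ideal.span_le]
    rintro x (rfl | rfl)
    · exact hJ0
    · exact hJ1
  have hsup : (jacobianIdeal f).map (chart v u w) ⊔ idealOfVars (Fin 2) ℂ ^ (2 * e + 1) =
      Ideal.span {pderiv 0 g, pderiv 1 g} ⊔ idealOfVars (Fin 2) ℂ ^ (2 * e + 1) := by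
    apply le_antisymm
    · refine sup_le (map_jacobianIdeal_le h hf
        (mem_span_pderiv_sup (r := e + 1 + 1) rfl he2 hmem) ?_ ?_) le_sup_right
      · exact Ideal.mem_sup_left (Ideal.subset_span (by simp [g]))
      · exact Ideal.mem_sup_left (Ideal.subset_span (by simp [g]))
    · exact sup_le_sup_right hle _
  refine ⟨2 * e + 1, ?_, ?_⟩
  · rw [hsup]
    exact finrank_quotient_span_pair_sup h0 h1 hrel
  · obtain ⟨r, hr, hr'⟩ := exists_notMem_mul_mem h0 h1 hrel
    exact ⟨r, hr, fun x hx => hle (hr' x hx)⟩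

/-- A point is singular on a union of smooth curves as soon as two of the curves meet there. -/
theorem isSingularPoint_prod_of_two_le {p : Plane} (h : 2 ≤ (through c p.rep).card) :
    IsSingularPoint (∏ i, c i) p := by
  classical
  obtain ⟨i, hi, j, hj, hij⟩ := Finset.one_lt_card.1 h
  rw [mem_through] at hi hj
  rw [← Finset.mul_prod_erase _ _ (Finset.mem_univ i), ← Finset.mul_prod_erase _ _
      (Finset.mem_erase.2 ⟨hij.symm, Finset.mem_univ j⟩)]
  refine ⟨?_, fun k => ?_⟩
  · simp [Vanishes, hi]
  · simp [Vanishes, hi, hj]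

theorem two_le_of_isSingularPoint {p : Plane} (hc : ∀ i, (c i).IsHomogeneous (n i))
    (hsm : ∀ i, eval p.rep (c i) = 0 → gradient (c i) p.rep ≠ 0)
    (hp : IsSingularPoint (∏ i, c i) p) : 2 ≤ (through c p.rep).card := by
  obtain ⟨f, hf, -⟩ := Submodule.exists_le_ker_of_notMem
    (p := (⊥ : Submodule ℂ (Fin 3 → ℂ))) (v := p.rep) (by simpa using p.rep_nonzero)
  obtain ⟨u, w, -, -, h⟩ := exists_linearIndependent_of_dual hf
  have h2 := (chart_prod_mem hc hsm h).2.1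
  have hgrad : gradient (∏ i, c i) p.rep = 0 := funext hp.2
  have h0 : (through c p.rep).card ≠ 0 := by
    intro h0
    rw [h0, homogeneousComponent_zero, ← constantCoeff_eq, ← eval_zero, eval_chart, Pi.zero_apply,
      Pi.zero_apply, zero_smul, zero_smul, add_zero, add_zero] at h2
    exact h2 (C_eq_zero.2 hp.1)
  have h1 : (through c p.rep).card ≠ 1 := by
    intro h1
    rw [h1, homogeneousComponent_one_chart, hgrad, zero_dotProduct, zero_dotProduct, C_0, zero_mul,
      zero_mul, add_zero] at h2
    exact h2 rfl
  exact (Nat.two_le_iff _).2 ⟨h0, h1⟩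

end Product

/-! ### Counting intersection points -/

section Count

theorem hasComponents_span_pair {f g : S} {a b : ℕ} (hf : f.IsHomogeneous a)
    (hg : g.IsHomogeneous b) : HasComponents (Ideal.span {f, g}) := by
  intro x hx j
  have hrange : ({f, g} : Set S) = Set.range ![f, g] := by simp [Set.pair_comm]
  rw [hrange] at hx ⊢
  refine homogeneousComponent_mem_span (n := ![a, b]) (fun i => ?_) hx j
  fin_cases i
  · exact hf
  · exact hg

theorem hasComponents_jacobianIdeal {f : S} {m : ℕ} (hf : f.IsHomogeneous m) :
    HasComponents (jacobianIdeal f) := fun _ hx j =>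
  homogeneousComponent_mem_span (fun _ => hf.pderiv) hx j

theorem mem_zeroSet_span_iff {s : Set S} {p : Plane} :
    p ∈ zeroSet (Ideal.span s) ↔ ∀ g ∈ s, Vanishes g p := by
  refine ⟨fun h g hg => h g (Ideal.subset_span hg), fun h => ?_⟩
  have : Ideal.span s ≤ RingHom.ker (eval p.rep) := Ideal.span_le.2 h
  exact fun g hg => this hg

theorem mem_zeroSet_jacobianIdeal_iff {f : S} {m : ℕ} (hm : m ≠ 0) (hf : f.IsHomogeneous m)
    {p : Plane} : p ∈ zeroSet (jacobianIdeal f) ↔ IsSingularPoint f p := by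
  rw [jacobianIdeal, mem_zeroSet_span_iff]
  constructor
  · intro h
    have h' : ∀ i, eval p.rep (pderiv i f) = 0 := fun i => h _ ⟨i, rfl⟩
    refine ⟨?_, h'⟩
    have := congrArg (eval p.rep) hf.sum_X_mul_pderiv
    rw [map_sum, map_nsmul, nsmul_eq_mul] at this
    simp only [map_mul, h', mul_zero, Finset.sum_const_zero] at this
    exact (mul_eq_zero.1 this.symm).resolve_left (by exact_mod_cast hm)
  · rintro h _ ⟨i, rfl⟩
    exact h.2 i

variable {ι : Type*} [Fintype ι] {c : ι → S} {n : ι → ℕ}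

/-- Bézout's theorem for two curves that meet transversally. -/
theorem card_zeroSet_pair [DecidableEq ι] (hn : ∀ i, 1 ≤ n i)
    (hc : ∀ i, (c i).IsHomogeneous (n i)) {i j : ι} (hij : i ≠ j) (hrel : IsRelPrime (c i) (c j))
    (htr : ∀ v : Fin 3 → ℂ, v ≠ 0 → PairwiseTransversal c v) (T : Finset Plane)
    (hT : ∀ p : Plane, i ∈ through c p.rep → j ∈ through c p.rep → p ∈ T) :
    n i * n j = (T.filter fun p : Plane => i ∈ through c p.rep ∧ j ∈ through c p.rep).card := by
  have hdeg := hasDegree_span_pair (hn i) (hc i) (hn j) (hc j) hrel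
  have hsum := hdeg.eq_sum (hasComponents_span_pair (hc i) (hc j)) (fun _ => 1) (by
    intro v hv hI u w h
    have hi := hI (c i) (Ideal.subset_span (by simp))
    have hj := hI (c j) (Ideal.subset_span (by simp))
    exact hasMultiplicity_span_pair h (hc i) (hc j) hi hj
      (htr v hv i (mem_through.2 hi) j (mem_through.2 hj) hij))
  rw [hsum, Finset.sum_const, smul_eq_mul, mul_one]
  congr 1
  ext p
  rw [Set.Finite.mem_toFinset, mem_zeroSet_span_iff, Finset.mem_filter]
  simp only [Set.mem_insert_iff, Set.mem_singleton_iff, forall_eq_or_imp, forall_eq]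
  constructor
  · rintro ⟨h1, h2⟩
    have h1' := mem_through.2 (show eval p.rep (c i) = 0 from h1)
    have h2' := mem_through.2 (show eval p.rep (c j) = 0 from h2)
    exact ⟨hT p h1' h2', h1', h2'⟩
  · rintro ⟨-, h1, h2⟩
    exact ⟨mem_through.1 h1, mem_through.1 h2⟩

/-- Counting the intersection points of ordered pairs of curves in two ways. -/
theorem sum_card_mul_card_sub_one [DecidableEq ι] (T : Finset Plane)
    (h : ∀ i j, i ≠ j →
      n i * n j = (T.filter fun p : Plane => i ∈ through c p.rep ∧ j ∈ through c p.rep).card) :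
    (∑ i, (n i : ℤ)) ^ 2 - ∑ i, (n i : ℤ) ^ 2 =
      ∑ p ∈ T, ((through c p.rep).card : ℤ) * ((through c p.rep).card - 1) := by
  have h1 : ∑ x ∈ (Finset.univ : Finset ι).offDiag, n x.1 * n x.2 =
      ∑ p ∈ T, (through c p.rep).offDiag.card := by
    rw [Finset.sum_congr rfl fun x hx => h x.1 x.2 (Finset.mem_offDiag.1 hx).2.2]
    simp_rw [Finset.card_filter]
    rw [Finset.sum_comm]
    refine Finset.sum_congr rfl fun p _ => ?_
    rw [← Finset.card_filter]
    congr 1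
    ext ⟨a, b⟩
    simp only [Finset.mem_filter, Finset.mem_offDiag, Finset.mem_univ, true_and]
    tauto
  have h2 : (∑ x ∈ (Finset.univ : Finset ι).offDiag, (n x.1 : ℤ) * n x.2) =
      ∑ p ∈ T, ((through c p.rep).card : ℤ) * ((through c p.rep).card - 1) := by
    have := congrArg (Nat.cast (R := ℤ)) h1
    push_cast at this
    rw [this]
    refine Finset.sum_congr rfl fun p _ => ?_
    rw [Finset.offDiag_card, Nat.cast_sub (Nat.le_mul_self _)]
    push_cast
    ring
  rw [← h2, sq, Finset.sum_mul_sum, ← Finset.sum_product',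
    ← Finset.diag_union_offDiag, Finset.sum_union (Finset.disjoint_diag_offDiag _),
    Finset.sum_diag]
  simp only [sq]
  ring

end Count

/-! ### Arrangements of conics and lines -/

namespace ConicLineArrangement

variable {k d : ℕ} (A : ConicLineArrangement k d)

/-- The degrees of the curves of an arrangement of `k` conics and `d` lines. -/
def componentDegree (k d : ℕ) : Fin k ⊕ Fin d → ℕ :=
  Sum.elim (fun _ => 2) (fun _ => 1)

theorem component_isHomogeneous (i : Fin k ⊕ Fin d) :
    (A.component i).IsHomogeneous (componentDegree k d i) := by
  rcases i with i | i
  · exact A.conic_homogeneous i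
  · exact A.line_homogeneous i

theorem gradient_component_ne_zero (i : Fin k ⊕ Fin d) {v : Fin 3 → ℂ} (hv : v ≠ 0)
    (h : eval v (A.component i) = 0) : gradient (A.component i) v ≠ 0 := by
  intro h0
  rcases i with i | i
  · have hi := A.conic_homogeneous i
    exact A.conic_smooth i (Projectivization.mk ℂ v hv)
      ⟨(vanishes_mk_iff hi hv).2 h, fun j => (vanishes_mk_iff hi.pderiv hv).2 (congrFun h0 j)⟩
  · have hi := A.line_homogeneous i
    apply A.line_ne_zero i
    rw [← one_smul ℕ (A.line i), ← hi.sum_X_mul_pderiv]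
    refine Finset.sum_eq_zero fun j _ => ?_
    have hC := totalDegree_eq_zero_iff_eq_C.1
      ((totalDegree_zero_iff_isHomogeneous _).2 (hi.pderiv (i := j)))
    have h1 : eval v (pderiv j (A.line i)) = 0 := congrFun h0 j
    rw [hC, eval_C] at h1
    rw [hC, h1, C_0, mul_zero]

theorem isRelPrime_component (hsq : Squarefree A.definingPolynomial) {i j : Fin k ⊕ Fin d}
    (hij : i ≠ j) : IsRelPrime (A.component i) (A.component j) := by
  apply IsRelPrime.of_squarefree_mul
  refine hsq.squarefree_of_dvd ?_
  rw [definingPolynomial, ← Finset.mul_prod_erase _ _ (Finset.mem_univ i),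
    ← Finset.mul_prod_erase _ _ (Finset.mem_erase.2 ⟨hij.symm, Finset.mem_univ j⟩), ← mul_assoc]
  exact dvd_mul_right _ _

theorem n_eq_card {T : Finset Plane} {r : ℕ}
    (hT : ∀ p : Plane, (through A.component p.rep).card = r → p ∈ T) :
    A.n r = {p ∈ T | (through A.component p.rep).card = r}.card := by
  rw [n, ← Set.ncard_coe_finset]
  congr 1
  ext p
  have h : {i | Vanishes (A.component i) p} = (through A.component p.rep : Set _) := by
    ext i
    rw [Finset.mem_coe, mem_through]
    rfl
  simp only [Set.mem_ofPred_eq, Finset.coe_filter, h, Set.ncard_coe_finset]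
  exact ⟨fun hp => ⟨hT p hp, hp⟩, fun hp => hp.2⟩

variable {A}

theorem card_and_pairwiseTransversal (hord : A.HasOrdinarySingularities 4) {v : Fin 3 → ℂ}
    (hv : v ≠ 0) (h : 2 ≤ (through A.component v).card) :
    (through A.component v).card ≤ 4 ∧ PairwiseTransversal A.component v := by
  obtain ⟨a, ha⟩ := Projectivization.exists_smul_eq_mk_rep ℂ v hv
  set p := Projectivization.mk ℂ v hv
  have hav : v = (a⁻¹ : ℂ) • p.rep := by
    rw [← ha, Units.smul_def, smul_smul, inv_mul_cancel₀ a.ne_zero, one_smul]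
  have ha0 : (a⁻¹ : ℂ) ≠ 0 := inv_ne_zero a.ne_zero
  rw [hav, through_smul A.component_isHomogeneous ha0] at h ⊢
  obtain ⟨j, hj, hjord⟩ := hord p (isSingularPoint_prod_of_two_le h)
  obtain ⟨rfl, htr⟩ := IsOrdinaryPoint.pairwiseTransversal hjord A.component_isHomogeneous
    fun i => A.gradient_component_ne_zero i p.rep_nonzero
  exact ⟨hj, htr.smul A.component_isHomogeneous ha0⟩

theorem pairwiseTransversal (hord : A.HasOrdinarySingularities 4) {v : Fin 3 → ℂ} (hv : v ≠ 0) :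
    PairwiseTransversal A.component v := by
  intro i hi j hj hij
  exact (card_and_pairwiseTransversal hord hv (Finset.one_lt_card.2 ⟨i, hi, j, hj, hij⟩)).2
    i hi j hj hij

theorem definingPolynomial_isHomogeneous (A : ConicLineArrangement k d) :
    A.definingPolynomial.IsHomogeneous (∑ i, componentDegree k d i) :=
  IsHomogeneous.prod _ _ _ fun i _ => A.component_isHomogeneous i

/-- Twice Bézout's count minus the degree of the Jacobian scheme weighs an ordinary point of
multiplicity `r` by `r (r - 1) - (r - 1) ^ 2 = r - 1`. -/
theorem n_add_n_add_n_eq (hd : d ≠ 0) (hord : A.HasOrdinarySingularities 4)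
    (hsq : Squarefree A.definingPolynomial) {δ : ℕ}
    (hδ : HasDegree (jacobianIdeal A.definingPolynomial) δ) :
    (A.n 2 : ℤ) + 2 * A.n 3 + 3 * A.n 4 = (2 * k + d) ^ 2 - (4 * k + d) - δ := by
  have hhom := A.definingPolynomial_isHomogeneous
  have hdeg0 : ∑ i, componentDegree k d i ≠ 0 := by
    simp [componentDegree, hd]
  have hsing : ∀ p, p ∈ hδ.finite_zeroSet.toFinset ↔ 2 ≤ (through A.component p.rep).card := by
    intro p
    rw [Set.Finite.mem_toFinset, mem_zeroSet_jacobianIdeal_iff hdeg0 hhom]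
    exact ⟨two_le_of_isSingularPoint A.component_isHomogeneous
      fun i => A.gradient_component_ne_zero i p.rep_nonzero, isSingularPoint_prod_of_two_le⟩
  have hsum := hδ.eq_sum (hasComponents_jacobianIdeal hhom)
    (fun p => ((through A.component p.rep).card - 1) ^ 2) (by
      intro v hv hI u w h
      obtain ⟨a, ha⟩ := Projectivization.exists_smul_eq_mk_rep ℂ v hv
      have hmem := (mk_mem_zeroSet_iff (hasComponents_jacobianIdeal hhom) hv).2 hI
      rw [← Set.Finite.mem_toFinset hδ.finite_zeroSet, hsing] at hmem
      rw [← ha, Units.smul_def, through_smul A.component_isHomogeneous a.ne_zero] at hmem ⊢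
      obtain ⟨hle, htr⟩ := card_and_pairwiseTransversal hord hv hmem
      obtain ⟨e, he⟩ := Nat.exists_eq_add_of_le hmem
      have he' : (through A.component v).card = e + 1 + 1 := by omega
      rw [he', Nat.add_sub_cancel]
      exact hasMultiplicity_jacobianIdeal A.component_isHomogeneous
        (fun i => A.gradient_component_ne_zero i hv) h htr he' (by omega))
  set T := hδ.finite_zeroSet.toFinset
  have hbezout := sum_card_mul_card_sub_one (c := A.component) (n := componentDegree k d) T
    fun i j hij => card_zeroSet_pair (n := componentDegree k d)
      (by rintro (i | i) <;> simp [componentDegree]) A.component_isHomogeneous hij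
      (A.isRelPrime_component hsq hij) (fun v hv => pairwiseTransversal hord hv) T
      fun p hi hj => (hsing p).2 (Finset.one_lt_card.2 ⟨i, hi, j, hj, hij⟩)
  have hsum1 : ∑ i, (componentDegree k d i : ℤ) = 2 * k + d := by
    simp [componentDegree, mul_comm]
  have hsum2 : ∑ i, (componentDegree k d i : ℤ) ^ 2 = 4 * k + d := by
    simp [componentDegree]
    ring
  rw [hsum1, hsum2] at hbezout
  have hn : ∀ r, 2 ≤ r → (A.n r : ℤ) =
      ∑ p ∈ T, if (through A.component p.rep).card = r then 1 else 0 := by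
    intro r hr
    rw [A.n_eq_card (T := T) fun p hp => (hsing p).2 (hp ▸ hr), Finset.card_filter]
    push_cast
    rfl
  rw [hbezout, hsum, hn 2 le_rfl, hn 3 (by norm_num), hn 4 (by norm_num), Nat.cast_sum,
    Finset.mul_sum, Finset.mul_sum, ← Finset.sum_add_distrib, ← Finset.sum_add_distrib,
    ← Finset.sum_sub_distrib]
  refine Finset.sum_congr rfl fun p hp => ?_
  have h2 := (hsing p).1 hp
  have h4 := (card_and_pairwiseTransversal hord p.rep_nonzero h2).1
  generalize (through A.component p.rep).card = r at h2 h4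
  interval_cases r <;> norm_num

end ConicLineArrangement

end MArrangement

theorem theorem3p1 {k d : ℕ} (hk : 1 ≤ k) (hd : 3 ≤ d)
    (A : MArrangement.ConicLineArrangement k d)
    (hord : A.HasOrdinarySingularities 4) (hM : A.IsMArrangement) :
    (∀ ℓ : ℕ, d = 2 * ℓ →
      (A.n 2 : ℤ) + 2 * A.n 3 + 3 * A.n 4 = ((k : ℤ) + ℓ) ^ 2 + ℓ - k - 3) ∧
    (∀ ℓ : ℕ, d = 2 * ℓ + 1 →
      (A.n 2 : ℤ) + 2 * A.n 3 + 3 * A.n 4 = ((k : ℤ) + ℓ) ^ 2 + 2 * ℓ - 1) := by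
  obtain ⟨δ, hδ, heven, hodd⟩ := hM.degree
  have key := MArrangement.ConicLineArrangement.n_add_n_add_n_eq (by omega) hord hM.reduced hδ
  constructor
  · rintro ℓ rfl
    have h := heven (k + ℓ) (by ring)
    rw [key, h]
    push_cast
    ring
  · rintro ℓ rfl
    have h := hodd (k + ℓ) (by ring)
    rw [key, h]
    push_cast
    ring
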